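/- Let $(M,g)$ be a smooth Riemannian manifold of dimension $m\ge 3$, with Levi-Civita connection $\nabla$, Riemann tensor $R_{ijkt}$ given by $\mathrm{Riem}(W,Z,X,Y)=\langle W,\nabla_X\nabla_YZ-\nabla_Y\nabla_XZ-\nabla_{[X,Y]}Z\rangle$, and Ricci tensor $R_{ij}=R^k{}_{ikj}$. On $q$-covariant tensors use the inner product $\langle A,B\rangle=A_{i_1\dots i_q}B^{i_1\dots i_q}$ and $|A|^2=\langle A,A\rangle$; $2$-forms carry the inner product of $2$-covariant tensors, $\langle\omega,\eta\rangle=\omega_{ij}\eta^{ij}$. Let $\mathfrak R$ be the curvature operator on $2$-forms, $(\mathfrak R\omega)_{kt}=R_{ijkt}\omega^{ij}$, and for $1\le k\le\binom m2$ and $x\in M$ let $$\mathfrak R^{(k)}(x)=\inf_{\substack{V\le\wedge^2_xM\\ \dim V=k}}\ \frac1k\sum_{\alpha=1}^k\langle\mathfrak R\psi^\alpha,\psi^\alpha\rangle,$$ where $\{\psi^\alpha\}_{\alpha=1}^k$ is any orthonormal basis of $V$ (equivalently, $\mathfrak R^{(k)}(x)$ is the average of the $k$ smallest eigenvalues of $\mathfrak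 R_x$). Let $\Gamma$ be Lichnerowicz's operator on $q$-covariant tensors, $$(\Gamma Q)_{i_1\dots i_q}=\sum_{l=1}^q R_{i_lj}\,Q_{i_1\dots}{}^{j}{}_{\dots i_q}-\sum_{1\le l\ne h\le q}R_{i_lji_ht}\,Q_{i_1\dots}{}^{j}{}_{\dots}{}^{t}{}_{\dots i_q},$$ with $j$ in the $l$-th and $t$ in the $h$-th place. An algebraic curvature tensor at $x$ is a $4$-covariant tensor $T$ on $T_xM$ with $T_{ijkt}=-T_{jikt}=T_{ktij}$ and $T_{ijkt}+T_{iktj}+T_{itjk}=0$; its Ricci contraction is $E_{ij}=T^k{}_{ikj}$, and its pseudo-projective tensor $P$ is $$P_{ijkt}=T_{ijkt}-\frac1{m-1}\left(g_{ik}E_{jt}-g_{it}E_{jk}\right).$$ Let $x\in M$ and $C\in\mathbb R$ be such that $\mathfrak R^{(\lfloor\frac{m-1}2\rfloor)}(x)\ge C$. Then every algebraic curvature tensor $T$ at $x$ satisfies $$\langle\Gamma T,T\rangle\ \ge\ 2(m-1)\,C\,|P|^2 .$$ -/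

import Mathlib

open Bundle
open scoped Manifold ContDiff

noncomputable section

namespace LichnerowiczBound

/-! ### Tensors on a finite-dimensional inner product space

A `q`-covariant tensor on `V` is evaluated on `q`-tuples `Fin q → V`. Components are taken with
respect to an orthonormal basis, so that raising and lowering indices leaves them unchanged. -/

section Algebra

variable {V : Type*} [NormedAddCommGroup V] [InnerProductSpace ℝ V] [FiniteDimensional ℝ V]

/-- An orthonormal frame of `V`. The contractions below do not depend on its choice. -/
def frame (V : Type*) [NormedAddCommGroup V] [InnerProductSpace ℝ V] [FiniteDimensional ℝ V] :
    OrthonormalBasis (Fin (Module.finrank ℝ V)) ℝ V :=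
  stdOrthonormalBasis ℝ V

/-- The inner product `⟨A, B⟩ = A_{i₁…i_q} B^{i₁…i_q}` of `q`-covariant tensors. -/
def tensorInner {q : ℕ} (A B : (Fin q → V) → ℝ) : ℝ :=
  ∑ i : Fin q → Fin (Module.finrank ℝ V),
    A (fun l => frame V (i l)) * B (fun l => frame V (i l))

/-- The Ricci contraction `E_{ij} = T^k_{ikj}` of a `4`-covariant tensor. -/
def ricciContraction (T : (Fin 4 → V) → ℝ) (u v : V) : ℝ :=
  ∑ a, T ![frame V a, u, frame V a, v]

/-- The endomorphism `(ℜη)_{kt} = R_{ijkt} η^{ij}` determined by a curvature tensor `R`. -/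
def curvatureOperator (R : (Fin 4 → V) → ℝ) (η : (Fin 2 → V) → ℝ) : (Fin 2 → V) → ℝ :=
  fun v => ∑ a, ∑ b, R ![frame V a, frame V b, v 0, v 1] * η ![frame V a, frame V b]

/-- The `k`-th normalized partial trace `ℜ^{(k)}`: the infimum of `(1/k) ∑ ⟨ℜψ^α, ψ^α⟩` over all
orthonormal bases `ψ¹, …, ψᵏ` of `k`-dimensional subspaces of the space of `2`-forms, that is,
over all orthonormal `k`-tuples of `2`-forms. The inner product of `2`-forms is the one of
`2`-covariant tensors. -/
def partialTrace (R : (Fin 4 → V) → ℝ) (k : ℕ) : ℝ :=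
  ⨅ ψ : {ψ : Fin k → V [⋀^Fin 2]→ₗ[ℝ] ℝ //
      ∀ α β, tensorInner (ψ α) (ψ β) = if α = β then 1 else 0},
    (1 / (k : ℝ)) * ∑ α, tensorInner (curvatureOperator R (ψ.1 α)) (ψ.1 α)

/-- Lichnerowicz's operator `Γ` on `q`-covariant tensors, determined by a curvature tensor `R`:
`(ΓQ)_{i₁…i_q} = ∑_l R_{i_l j} Q_{…}^{j}_{…} - ∑_{l ≠ h} R_{i_l j i_h t} Q_{…}^{j}_{…}^{t}_{…}`
with `j` in the `l`-th place and `t` in the `h`-th place. -/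
def lichnerowicz (R : (Fin 4 → V) → ℝ) {q : ℕ} (Q : (Fin q → V) → ℝ) : (Fin q → V) → ℝ :=
  fun v =>
    (∑ l, ∑ a, ricciContraction R (v l) (frame V a) * Q (Function.update v l (frame V a)))
    - ∑ l, ∑ h, if l = h then 0 else
        ∑ a, ∑ b, R ![v l, frame V a, v h, frame V b] *
          Q (Function.update (Function.update v l (frame V a)) h (frame V b))

/-- Algebraic curvature tensors: `4`-covariant tensors with the symmetries of the Riemann tensor
and the first Bianchi identity. -/
structure IsAlgebraicCurvatureTensor (T : MultilinearMap ℝ (fun _ : Fin 4 => V) ℝ) : Prop where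
  antisymm : ∀ x y z w, T ![x, y, z, w] = -T ![y, x, z, w]
  pair_symm : ∀ x y z w, T ![x, y, z, w] = T ![z, w, x, y]
  bianchi : ∀ x y z w, T ![x, y, z, w] + T ![x, z, w, y] + T ![x, w, y, z] = 0

/-- The pseudo-projective tensor
`P_{ijkt} = T_{ijkt} - (g_{ik} E_{jt} - g_{it} E_{jk}) / (m - 1)`, with `m = dim V`. -/
def pseudoProjective (T : (Fin 4 → V) → ℝ) : (Fin 4 → V) → ℝ :=
  fun v => T v - 1 / ((Module.finrank ℝ V : ℝ) - 1) *
    (inner ℝ (v 0) (v 2) * ricciContraction T (v 1) (v 3)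
      - inner ℝ (v 0) (v 3) * ricciContraction T (v 1) (v 2))

end Algebra

/-! ### The Riemann tensor of a Riemannian manifold, in the chart around a point -/

section Curvature

variable {m : ℕ} {M : Type*} [TopologicalSpace M] [ChartedSpace (EuclideanSpace ℝ (Fin m)) M]
  [RiemannianBundle (fun x : M => TangentSpace (𝓡 m) x)]

instance (x : M) : FiniteDimensional ℝ (TangentSpace (𝓡 m) x) :=
  inferInstanceAs (FiniteDimensional ℝ (EuclideanSpace ℝ (Fin m)))

/-- The partial derivative `∂_i f` of a function on `ℝᵐ`. -/
def partialDeriv (i : Fin m) (f : EuclideanSpace ℝ (Fin m) → ℝ) (y : EuclideanSpace ℝ (Fin m)) :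
    ℝ :=
  fderiv ℝ f y (EuclideanSpace.single i 1)

/-- The `i`-th coordinate vector field of the chart around `x`, at the point with
coordinates `y`. -/
def coordVector (x : M) (i : Fin m) (y : EuclideanSpace ℝ (Fin m)) :
    TangentSpace (𝓡 m) ((extChartAt (𝓡 m) x).symm y) :=
  mfderiv 𝓘(ℝ, EuclideanSpace ℝ (Fin m)) (𝓡 m) (extChartAt (𝓡 m) x).symm y
    (EuclideanSpace.single i (1 : ℝ) : EuclideanSpace ℝ (Fin m))

/-- The components `g_{ij}` of the metric in the chart around `x`. -/
def metricCoord (x : M) (i j : Fin m) (y : EuclideanSpace ℝ (Fin m)) : ℝ :=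
  inner ℝ (coordVector x i y) (coordVector x j y)

/-- The components `g^{ij}` of the inverse metric in the chart around `x`. -/
def invMetricCoord (x : M) (i j : Fin m) (y : EuclideanSpace ℝ (Fin m)) : ℝ :=
  (Matrix.of fun a b => metricCoord x a b y)⁻¹ i j

/-- The Christoffel symbols `Γ^k_{ij}` of the Levi-Civita connection. -/
def christoffel (x : M) (k i j : Fin m) (y : EuclideanSpace ℝ (Fin m)) : ℝ :=
  (1 / 2) * ∑ l, invMetricCoord x k l y *
    (partialDeriv i (metricCoord x j l) y + partialDeriv j (metricCoord x i l) y
      - partialDeriv l (metricCoord x i j) y)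

/-- The component along `∂_p` of
`R(∂_i, ∂_j)∂_k = ∇_{∂_i}∇_{∂_j}∂_k - ∇_{∂_j}∇_{∂_i}∂_k`. -/
def curvatureCoord (x : M) (p k i j : Fin m) (y : EuclideanSpace ℝ (Fin m)) : ℝ :=
  partialDeriv i (christoffel x p j k) y - partialDeriv j (christoffel x p i k) y
    + ∑ s, (christoffel x p i s y * christoffel x s j k y
      - christoffel x p j s y * christoffel x s i k y)

/-- The components `R_{lkij} = ⟨∂_l, R(∂_i, ∂_j)∂_k⟩` of the Riemann tensor. -/
def riemannCoord (x : M) (l k i j : Fin m) (y : EuclideanSpace ℝ (Fin m)) : ℝ :=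
  ∑ p, metricCoord x l p y * curvatureCoord x p k i j y

/-- The coordinate covector `dxⁱ` at `x`. -/
def coordCovector (x : M) (i : Fin m) (v : TangentSpace (𝓡 m) x) : ℝ :=
  (show EuclideanSpace ℝ (Fin m) from
    mfderiv (𝓡 m) 𝓘(ℝ, EuclideanSpace ℝ (Fin m)) (extChartAt (𝓡 m) x) x v) i

/-- The Riemann curvature tensor `Riem(W, Z, X, Y) = ⟨W, R(X, Y)Z⟩` at the point `x`. -/
def riemannTensor (x : M) : (Fin 4 → TangentSpace (𝓡 m) x) → ℝ :=
  fun v => ∑ l, ∑ k, ∑ i, ∑ j, riemannCoord x l k i j (extChartAt (𝓡 m) x x) *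
    (coordCovector x l (v 0) * coordCovector x k (v 1) *
      coordCovector x i (v 2) * coordCovector x j (v 3))

end Curvature

end LichnerowiczBound

end

open scoped Topology

noncomputable section

namespace LichnerowiczBound

/-! ### Symmetries of the Riemann tensor in a chart -/

section RiemannSymmetries

variable {m : ℕ} {M : Type*} [TopologicalSpace M] [ChartedSpace (EuclideanSpace ℝ (Fin m)) M]

/-! The curvature operator is symmetric, so it has an orthonormal eigenbasis of 2-forms ψ^α with
eigenvalues λ_α. Letting a skew matrix act on tensors as a derivation, one has ⟨ΓT,T⟩ = ∑ λ_α w_α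
with w_α = |ψ^α T|² (`lichnerowiczForm_eq_sum`). The same formula for the curvature tensor whose
operator is the identity gives the total weight: ∑ w_α = 2(m-1)|T|² - 4|E|² = 2(m-1)|P|²
(`lichnerowiczForm_unitCurvature`, `tensorInner_pseudoProjective`).

The main estimate is that no single weight is large: w_α ≤ 4|P|² (`sum4_act_sq_le`). Write T = W +
g∧S, with W trace-free, S a multiple of the Schouten tensor and ∧ the Kulkarni–Nomizu product. The
derivation preserves this orthogonal splitting. On W it is a sum of two commutators of skew
matrices, controlled by |[A,B]|² ≤ |A|²|B|² (`frobSq_commutator_skew_le`). On g∧S it is g∧[S,ψ],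
controlled by |[S,ψ]|² ≤ 2|S°|²|ψ|² with S° the traceless part (`frobSq_commutator_symm_le`).

Hence, for k = ⌊(m-1)/2⌋, each weight is at most a k-th part of the total. Under this constraint ∑
λ_α w_α is at least the total weight times any lower bound for averages of k eigenvalues
(`mul_sum_le_sum_mul_of_card`), and C is such a bound. The manifold enters only through two
symmetries of its Riemann tensor, skewness and pair symmetry. -/

lemma contDiffAt_partialDeriv {f : EuclideanSpace ℝ (Fin m) → ℝ} {y : EuclideanSpace ℝ (Fin m)}
    (hf : ContDiffAt ℝ ∞ f y) (i : Fin m) : ContDiffAt ℝ ∞ (partialDeriv i f) y :=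
  (hf.fderiv_right (m := ∞) (by simp)).clm_apply contDiffAt_const

lemma partialDeriv_comm {f : EuclideanSpace ℝ (Fin m) → ℝ} {y : EuclideanSpace ℝ (Fin m)}
    (hf : ContDiffAt ℝ ∞ f y) (i j : Fin m) :
    partialDeriv i (partialDeriv j f) y = partialDeriv j (partialDeriv i f) y := by
  have hd : DifferentiableAt ℝ (fderiv ℝ f) y :=
    (hf.fderiv_right (m := ∞) (by simp)).differentiableAt (by simp)
  have hs := hf.isSymmSndFDerivAt (by simpa using WithTop.coe_le_coe.2 (le_top : (2 : ℕ∞) ≤ ⊤))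
    (EuclideanSpace.single i 1) (EuclideanSpace.single j 1)
  unfold partialDeriv
  rw [fderiv_clm_apply hd (by fun_prop), fderiv_clm_apply hd (by fun_prop)]
  simpa using hs

lemma differentiableAt_det {E : Type*} [NormedAddCommGroup E] [NormedSpace ℝ E]
    {n : Type*} [Fintype n] [DecidableEq n] {A : E → Matrix n n ℝ} {y : E}
    (hA : ∀ i j, DifferentiableAt ℝ (fun z => A z i j) y) :
    DifferentiableAt ℝ (fun z => (A z).det) y := by
  simp only [Matrix.det_apply]
  refine DifferentiableAt.fun_sum fun σ _ => DifferentiableAt.fun_const_smul ?_ _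
  exact (HasFDerivAt.finsetProd fun i _ => (hA (σ i) i).hasFDerivAt).differentiableAt

/-- The coordinate field is the tangent map of the inverse chart applied to a constant section, so
smoothness of the chart suffices. -/
lemma contMDiffAt_coordVector [IsManifold (𝓡 m) ∞ M] (x : M) (i : Fin m) {y : EuclideanSpace ℝ (Fin m)}
    (hy : y ∈ (extChartAt (𝓡 m) x).target) :
    ContMDiffAt 𝓘(ℝ, EuclideanSpace ℝ (Fin m)) ((𝓡 m).prod 𝓘(ℝ, EuclideanSpace ℝ (Fin m))) ∞
      (fun z => (⟨(extChartAt (𝓡 m) x).symm z, coordVector x i z⟩ :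
        TangentBundle (𝓡 m) M)) y := by
  have hopen : IsOpen (extChartAt (𝓡 m) x).target := isOpen_extChartAt_target x
  have h1 := (contMDiffOn_extChartAt_symm (n := ∞) (I := 𝓡 m) x).contMDiffOn_tangentMapWithin
    (m := ∞) (by simp) hopen.uniqueMDiffOn
  have h2 : ContMDiff 𝓘(ℝ, EuclideanSpace ℝ (Fin m))
      ((𝓘(ℝ, EuclideanSpace ℝ (Fin m))).prod 𝓘(ℝ, EuclideanSpace ℝ (Fin m))) ∞
      (fun z : EuclideanSpace ℝ (Fin m) => (⟨z, EuclideanSpace.single i (1:ℝ)⟩ :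
        TangentBundle 𝓘(ℝ, EuclideanSpace ℝ (Fin m)) (EuclideanSpace ℝ (Fin m)))) := by
    exact contMDiff_vectorSpace_iff_contDiff.2 contDiff_const
  have h3 := (h1.comp h2.contMDiffOn (s := (extChartAt (𝓡 m) x).target) (fun z hz => hz)).contMDiffAt
    (hopen.mem_nhds hy)
  refine h3.congr_of_eventuallyEq ?_
  filter_upwards [hopen.mem_nhds hy] with z hz
  simp only [Function.comp, tangentMapWithin, coordVector]
  rw [mfderivWithin_of_isOpen hopen hz]

variable [RiemannianBundle (fun x : M => TangentSpace (𝓡 m) x)]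

lemma metricCoord_comm (x : M) (i j : Fin m) (y : EuclideanSpace ℝ (Fin m)) :
    metricCoord x i j y = metricCoord x j i y := real_inner_comm _ _

/-- The Christoffel symbols `Γ_{l,ij}` of the first kind. -/
def christoffelLow (x : M) (l i j : Fin m) (y : EuclideanSpace ℝ (Fin m)) : ℝ :=
  (1 / 2) * (partialDeriv i (metricCoord x j l) y + partialDeriv j (metricCoord x i l) y
    - partialDeriv l (metricCoord x i j) y)

lemma metricCoord_comm_fun (x : M) (i j : Fin m) : metricCoord x i j = metricCoord x j i :=
  funext fun y => metricCoord_comm x i j y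

lemma christoffel_comm (x : M) (k i j : Fin m) (y : EuclideanSpace ℝ (Fin m)) :
    christoffel x k i j y = christoffel x k j i y := by
  unfold christoffel
  congr 1
  refine Finset.sum_congr rfl fun l _ => ?_
  rw [metricCoord_comm_fun x i j]
  ring

/-- This is compatibility of the connection with the metric. -/
lemma partialDeriv_metricCoord (x : M) (i l p : Fin m) (y : EuclideanSpace ℝ (Fin m)) :
    partialDeriv i (metricCoord x l p) y = christoffelLow x l i p y + christoffelLow x p i l y := by
  unfold christoffelLow
  rw [metricCoord_comm_fun x p l]
  ring

lemma christoffelLow_comm (x : M) (l i j : Fin m) (y : EuclideanSpace ℝ (Fin m)) :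
    christoffelLow x l i j y = christoffelLow x l j i y := by
  unfold christoffelLow
  rw [metricCoord_comm_fun x i j]
  ring

variable [IsManifold (𝓡 m) ∞ M]

/-- The metric matrix is the Gram matrix of the coordinate vectors, which are independent because
the derivative of the inverse chart is invertible. Without this, the matrix inverse in
`invMetricCoord` could be a default value. -/
lemma isUnit_det_metricCoord (x : M) {y : EuclideanSpace ℝ (Fin m)}
    (hy : y ∈ (extChartAt (𝓡 m) x).target) :
    IsUnit (Matrix.of fun a b => metricCoord x a b y).det := by
  have : IsManifold (𝓡 m) 1 M := IsManifold.of_le (n := ∞) (by exact_mod_cast le_top)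
  have hinv := isInvertible_mfderivWithin_extChartAt_symm (I := 𝓡 m) hy
  rw [ModelWithCorners.range_eq_univ, mfderivWithin_univ] at hinv
  have hli : LinearIndependent ℝ (fun i => coordVector x i y) := by
    have h0 := (EuclideanSpace.basisFun (Fin m) ℝ).toBasis.linearIndependent
    have h1 := h0.map' (mfderiv 𝓘(ℝ, EuclideanSpace ℝ (Fin m)) (𝓡 m)
      (extChartAt (𝓡 m) x).symm y).toLinearMap
      (LinearMap.ker_eq_bot.2 hinv.bijective.injective)
    have h2 : (fun i => coordVector x i y) = (mfderiv 𝓘(ℝ, EuclideanSpace ℝ (Fin m)) (𝓡 m)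
        (extChartAt (𝓡 m) x).symm y).toLinearMap ∘
          (EuclideanSpace.basisFun (Fin m) ℝ).toBasis := by
      funext i
      simp [coordVector, Function.comp]
      rfl
    rw [h2]
    exact h1
  exact (Matrix.posDef_gram_of_linearIndependent hli).det_pos.ne'.isUnit

lemma sum_metricCoord_mul_christoffel (x : M) (l i j : Fin m) {y : EuclideanSpace ℝ (Fin m)}
    (hy : y ∈ (extChartAt (𝓡 m) x).target) :
    ∑ p, metricCoord x l p y * christoffel x p i j y = christoffelLow x l i j y := by
  have h : ∀ q, ∑ p, metricCoord x l p y * invMetricCoord x p q y = if l = q then 1 else 0 := by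
    intro q
    have := congrFun (congrFun (Matrix.mul_nonsing_inv _ (isUnit_det_metricCoord x hy)) l) q
    rw [Matrix.mul_apply, Matrix.one_apply] at this
    exact this
  unfold christoffel
  simp only [Finset.mul_sum]
  rw [Finset.sum_comm]
  have h' : ∀ q, ∑ p, metricCoord x l p y * (1 / 2 * (invMetricCoord x p q y *
      (partialDeriv i (metricCoord x j q) y + partialDeriv j (metricCoord x i q) y
      - partialDeriv q (metricCoord x i j) y))) =
      (if l = q then 1 else 0) * christoffelLow x q i j y := by
    intro q
    rw [← h, Finset.sum_mul]
    refine Finset.sum_congr rfl fun p _ => ?_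
    unfold christoffelLow
    ring
  rw [Finset.sum_congr rfl fun q _ => h' q]
  simp

/-- Both sides are g_{pq} Γ^q_{il} Γ^p_{jk}, and the metric is symmetric. -/
lemma sum_christoffelLow_mul_christoffel_comm (x : M) (i l j k : Fin m)
    {y : EuclideanSpace ℝ (Fin m)} (hy : y ∈ (extChartAt (𝓡 m) x).target) :
    ∑ p, christoffelLow x p i l y * christoffel x p j k y =
      ∑ p, christoffelLow x p j k y * christoffel x p i l y := by
  simp only [← sum_metricCoord_mul_christoffel x _ _ _ hy, Finset.sum_mul]
  rw [Finset.sum_comm]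
  refine Finset.sum_congr rfl fun p _ => Finset.sum_congr rfl fun q _ => ?_
  rw [metricCoord_comm]
  ring

variable [IsContMDiffRiemannianBundle (𝓡 m) ∞ (EuclideanSpace ℝ (Fin m))
      (fun x : M => TangentSpace (𝓡 m) x)]

lemma contDiffAt_metricCoord (x : M) (i j : Fin m) {y : EuclideanSpace ℝ (Fin m)}
    (hy : y ∈ (extChartAt (𝓡 m) x).target) : ContDiffAt ℝ ∞ (metricCoord x i j) y := by
  rw [← contMDiffAt_iff_contDiffAt]
  exact (contMDiffAt_coordVector x i hy).inner_bundle (contMDiffAt_coordVector x j hy)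


lemma differentiableAt_metricCoord (x : M) (i j : Fin m) {y : EuclideanSpace ℝ (Fin m)}
    (hy : y ∈ (extChartAt (𝓡 m) x).target) : DifferentiableAt ℝ (metricCoord x i j) y :=
  (contDiffAt_metricCoord x i j hy).differentiableAt (by simp)

lemma differentiableAt_invMetricCoord (x : M) (i j : Fin m) {y : EuclideanSpace ℝ (Fin m)}
    (hy : y ∈ (extChartAt (𝓡 m) x).target) : DifferentiableAt ℝ (invMetricCoord x i j) y := by
  have h := isUnit_det_metricCoord x hy
  have hd : DifferentiableAt ℝ (fun z => (Matrix.of fun a b => metricCoord x a b z).det) y :=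
    differentiableAt_det fun i j => differentiableAt_metricCoord x i j hy
  have ha : DifferentiableAt ℝ
      (fun z => (Matrix.of fun a b => metricCoord x a b z).adjugate i j) y := by
    simp only [Matrix.adjugate_apply]
    refine differentiableAt_det fun a b => ?_
    simp only [Matrix.updateRow_apply]
    split_ifs
    · fun_prop
    · exact differentiableAt_metricCoord x _ _ hy
  unfold invMetricCoord
  -- Cramer's rule: the inverse is the adjugate over the determinant, both polynomial in the metric
  -- components.
  simp only [Matrix.inv_def, Ring.inverse_eq_inv', Matrix.smul_apply, smul_eq_mul]
  exact (hd.inv h.ne_zero).mul ha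

lemma differentiableAt_christoffel (x : M) (k i j : Fin m) {y : EuclideanSpace ℝ (Fin m)}
    (hy : y ∈ (extChartAt (𝓡 m) x).target) : DifferentiableAt ℝ (christoffel x k i j) y := by
  have h (a b c : Fin m) : DifferentiableAt ℝ (partialDeriv a (metricCoord x b c)) y :=
    (contDiffAt_partialDeriv (contDiffAt_metricCoord x b c hy) a).differentiableAt (by simp)
  unfold christoffel
  refine DifferentiableAt.const_mul (DifferentiableAt.fun_sum fun l _ => ?_) _
  exact (differentiableAt_invMetricCoord x k l hy).mul (((h _ _ _).add (h _ _ _)).sub (h _ _ _))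

/-- Product rule applied to the index-lowering identity, which holds on the whole chart target and
may therefore be differentiated at `y`. -/
lemma sum_metricCoord_mul_partialDeriv_christoffel (x : M) (a l i j : Fin m)
    {y : EuclideanSpace ℝ (Fin m)} (hy : y ∈ (extChartAt (𝓡 m) x).target) :
    ∑ p, metricCoord x l p y * partialDeriv a (christoffel x p i j) y =
      partialDeriv a (christoffelLow x l i j) y -
        ∑ p, partialDeriv a (metricCoord x l p) y * christoffel x p i j y := by
  have he : christoffelLow x l i j =ᶠ[𝓝 y]
      fun z => ∑ p, metricCoord x l p z * christoffel x p i j z := by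
    filter_upwards [(isOpen_extChartAt_target x).mem_nhds hy] with z hz
    exact (sum_metricCoord_mul_christoffel x l i j hz).symm
  have hg := fun p => differentiableAt_metricCoord x l p hy
  have hc := fun p => differentiableAt_christoffel x p i j hy
  have h : partialDeriv a (christoffelLow x l i j) y = ∑ p,
      (metricCoord x l p y * partialDeriv a (christoffel x p i j) y +
        partialDeriv a (metricCoord x l p) y * christoffel x p i j y) := by
    unfold partialDeriv
    rw [he.fderiv_eq, fderiv_fun_sum fun p _ => (hg p).fun_mul (hc p)]
    simp only [sum_apply]
    refine Finset.sum_congr rfl fun p _ => ?_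
    rw [fderiv_fun_mul (hg p) (hc p)]
    simp [mul_comm]
  rw [h, Finset.sum_add_distrib]
  ring

lemma partialDeriv_christoffelLow (x : M) (a l i j : Fin m)
    {y : EuclideanSpace ℝ (Fin m)} (hy : y ∈ (extChartAt (𝓡 m) x).target) :
    partialDeriv a (christoffelLow x l i j) y =
      (1 / 2) * (partialDeriv a (partialDeriv i (metricCoord x j l)) y
        + partialDeriv a (partialDeriv j (metricCoord x i l)) y
        - partialDeriv a (partialDeriv l (metricCoord x i j)) y) := by
  have h (a b c : Fin m) : DifferentiableAt ℝ (partialDeriv a (metricCoord x b c)) y :=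
    (contDiffAt_partialDeriv (contDiffAt_metricCoord x b c hy) a).differentiableAt (by simp)
  have h1 := (((h i j l).hasFDerivAt.add (h j i l).hasFDerivAt).sub
    (h l i j).hasFDerivAt).const_mul (1 / 2 : ℝ)
  have h2 : HasFDerivAt (christoffelLow x l i j) _ y := h1
  rw [partialDeriv, h2.fderiv]
  simp [partialDeriv]

/-- Lowering the index under the derivative produces terms ∂g·Γ. By metric compatibility half of
them cancel the quadratic terms of the curvature, and the remaining form displays the symmetries:
second derivatives of g plus pairings of Christoffel symbols. -/
lemma riemannCoord_eq (x : M) (l k i j : Fin m)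
    {y : EuclideanSpace ℝ (Fin m)} (hy : y ∈ (extChartAt (𝓡 m) x).target) :
    riemannCoord x l k i j y =
      partialDeriv i (christoffelLow x l j k) y - partialDeriv j (christoffelLow x l i k) y
      - ∑ p, christoffelLow x p i l y * christoffel x p j k y
      + ∑ p, christoffelLow x p j l y * christoffel x p i k y := by
  have hq (i j : Fin m) : ∑ p, metricCoord x l p y *
      ∑ s, christoffel x p i s y * christoffel x s j k y =
      ∑ s, christoffelLow x l i s y * christoffel x s j k y := by
    simp only [Finset.mul_sum]
    rw [Finset.sum_comm]
    refine Finset.sum_congr rfl fun s _ => ?_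
    rw [← sum_metricCoord_mul_christoffel x l i s hy, Finset.sum_mul]
    exact Finset.sum_congr rfl fun p _ => by ring
  unfold riemannCoord curvatureCoord
  simp only [Finset.sum_sub_distrib, mul_add, mul_sub, Finset.sum_add_distrib, hq,
    sum_metricCoord_mul_partialDeriv_christoffel x _ _ _ _ hy]
  simp only [partialDeriv_metricCoord, add_mul, Finset.sum_add_distrib]
  ring

lemma riemannCoord_antisymm_left (x : M) (l k i j : Fin m)
    {y : EuclideanSpace ℝ (Fin m)} (hy : y ∈ (extChartAt (𝓡 m) x).target) :
    riemannCoord x l k i j y = -riemannCoord x k l i j y := by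
  rw [riemannCoord_eq x l k i j hy, riemannCoord_eq x k l i j hy,
    sum_christoffelLow_mul_christoffel_comm x i k j l hy,
    sum_christoffelLow_mul_christoffel_comm x j k i l hy]
  simp only [partialDeriv_christoffelLow x _ _ _ _ hy]
  rw [metricCoord_comm_fun x l k, partialDeriv_comm (contDiffAt_metricCoord x k l hy) i j]
  ring

lemma riemannCoord_pair_symm (x : M) (l k i j : Fin m)
    {y : EuclideanSpace ℝ (Fin m)} (hy : y ∈ (extChartAt (𝓡 m) x).target) :
    riemannCoord x l k i j y = riemannCoord x i j l k y := by
  rw [riemannCoord_eq x l k i j hy, riemannCoord_eq x i j l k hy]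
  simp only [partialDeriv_christoffelLow x _ _ _ _ hy, christoffelLow_comm x _ l i,
    christoffelLow_comm x _ k i, christoffel_comm x _ k j, christoffel_comm x _ l j]
  rw [sum_christoffelLow_mul_christoffel_comm x j l i k hy]
  rw [partialDeriv_comm (contDiffAt_metricCoord x k l hy) i j,
    partialDeriv_comm (contDiffAt_metricCoord x j i hy) l k,
    partialDeriv_comm (contDiffAt_metricCoord x j l hy) i k,
    partialDeriv_comm (contDiffAt_metricCoord x j k hy) i l,
    partialDeriv_comm (contDiffAt_metricCoord x i k hy) j l,
    partialDeriv_comm (contDiffAt_metricCoord x i l hy) j k, metricCoord_comm_fun x k l,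
    metricCoord_comm_fun x k j, metricCoord_comm_fun x l j,
    metricCoord_comm_fun x k i, metricCoord_comm_fun x l i]
  ring

lemma riemannTensor_antisymm_left (x : M) (u v w z : TangentSpace (𝓡 m) x) :
    riemannTensor x ![u, v, w, z] = -riemannTensor x ![v, u, w, z] := by
  simp only [riemannTensor, ← Finset.sum_neg_distrib]
  rw [Finset.sum_comm]
  refine Finset.sum_congr rfl fun k _ => Finset.sum_congr rfl fun l _ =>
    Finset.sum_congr rfl fun i _ => Finset.sum_congr rfl fun j _ => ?_
  rw [riemannCoord_antisymm_left x l k i j (mem_extChartAt_target x)]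
  simp only [Matrix.cons_val]
  ring

lemma riemannTensor_pair_symm (x : M) (u v w z : TangentSpace (𝓡 m) x) :
    riemannTensor x ![u, v, w, z] = riemannTensor x ![w, z, u, v] := by
  simp only [riemannTensor]
  calc _ = ∑ l, ∑ i, ∑ k, ∑ j, _ := Finset.sum_congr rfl fun l _ => Finset.sum_comm
    _ = ∑ i, ∑ l, ∑ k, ∑ j, _ := Finset.sum_comm
    _ = ∑ i, ∑ l, ∑ j, ∑ k, _ := Finset.sum_congr rfl fun i _ => Finset.sum_congr rfl fun l _ =>
        Finset.sum_comm
    _ = ∑ i, ∑ j, ∑ l, ∑ k, _ := Finset.sum_congr rfl fun i _ => Finset.sum_comm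
    _ = _ := ?_
  refine Finset.sum_congr rfl fun k _ => Finset.sum_congr rfl fun l _ =>
    Finset.sum_congr rfl fun i _ => Finset.sum_congr rfl fun j _ => ?_
  rw [riemannCoord_pair_symm x _ _ _ _ (mem_extChartAt_target x)]
  simp only [Matrix.cons_val]
  ring

end RiemannSymmetries

/-! ### Commutator bounds in the Frobenius norm -/

section Frobenius

open Matrix

variable {ι κ τ : Type} [Fintype ι] [Fintype κ] [Fintype τ]

/-- The squared Frobenius norm of a real matrix. -/
def frobSq (A : Matrix ι κ ℝ) : ℝ := ∑ i, ∑ j, A i j ^ 2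

lemma frobSq_nonneg (A : Matrix ι κ ℝ) : 0 ≤ frobSq A :=
  Finset.sum_nonneg fun _ _ => Finset.sum_nonneg fun _ _ => sq_nonneg _

lemma eq_zero_of_frobSq_le_zero {A : Matrix ι κ ℝ} (h : frobSq A ≤ 0) : A = 0 := by
  have h1 := h.antisymm (frobSq_nonneg A)
  unfold frobSq at h1
  ext i j
  have h2 := (Finset.sum_eq_zero_iff_of_nonneg
    fun i _ => Finset.sum_nonneg fun j _ => sq_nonneg (A i j)).1 h1 i (Finset.mem_univ i)
  have h3 := (Finset.sum_eq_zero_iff_of_nonneg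
    fun j _ => sq_nonneg (A i j)).1 h2 j (Finset.mem_univ j)
  simpa using h3

lemma frobSq_eq_trace (A : Matrix ι κ ℝ) : frobSq A = (Aᵀ * A).trace := by
  simp only [frobSq, Matrix.trace, Matrix.diag, Matrix.mul_apply, Matrix.transpose_apply]
  rw [Finset.sum_comm]
  simp only [sq]

lemma frobSq_transpose (A : Matrix ι κ ℝ) : frobSq Aᵀ = frobSq A := by
  simp only [frobSq, Matrix.transpose_apply]
  exact Finset.sum_comm

lemma frobSq_neg (A : Matrix ι κ ℝ) : frobSq (-A) = frobSq A := by
  simp [frobSq]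

lemma frobSq_sub_le (A B : Matrix ι κ ℝ) : frobSq (A - B) ≤ 2 * frobSq A + 2 * frobSq B := by
  simp only [frobSq, Finset.mul_sum, ← Finset.sum_add_distrib, Matrix.sub_apply]
  refine Finset.sum_le_sum fun i _ => Finset.sum_le_sum fun j _ => ?_
  nlinarith [sq_nonneg (A i j + B i j)]

lemma frobSq_mul_right_of_mul_transpose [DecidableEq κ] (A : Matrix ι κ ℝ) {U : Matrix κ τ ℝ}
    (hU : U * Uᵀ = 1) : frobSq (A * U) = frobSq A := by
  rw [frobSq_eq_trace, frobSq_eq_trace, Matrix.transpose_mul, Matrix.mul_assoc,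
    Matrix.trace_mul_comm, Matrix.mul_assoc, Matrix.mul_assoc, hU, Matrix.mul_one]

lemma frobSq_transpose_mul_of_mul_transpose [DecidableEq κ] (A : Matrix κ ι ℝ) {U : Matrix κ τ ℝ}
    (hU : U * Uᵀ = 1) : frobSq (Uᵀ * A) = frobSq A := by
  rw [← frobSq_transpose, Matrix.transpose_mul, Matrix.transpose_transpose,
    frobSq_mul_right_of_mul_transpose _ hU, frobSq_transpose]

lemma frobSq_conj [DecidableEq κ] (A : Matrix κ κ ℝ) {U : Matrix κ τ ℝ}
    (hU : U * Uᵀ = 1) : frobSq (Uᵀ * A * U) = frobSq A := by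
  rw [frobSq_mul_right_of_mul_transpose _ hU, frobSq_transpose_mul_of_mul_transpose _ hU]

lemma frobSq_fromBlocks {ι' κ' : Type} [Fintype ι'] [Fintype κ'] (A : Matrix ι κ ℝ)
    (B : Matrix ι κ' ℝ) (C : Matrix ι' κ ℝ) (D : Matrix ι' κ' ℝ) :
    frobSq (fromBlocks A B C D) = frobSq A + frobSq B + frobSq C + frobSq D := by
  simp only [frobSq, Fintype.sum_sum_type, Matrix.fromBlocks_apply₁₁, Matrix.fromBlocks_apply₁₂,
    Matrix.fromBlocks_apply₂₁, Matrix.fromBlocks_apply₂₂, Finset.sum_add_distrib]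
  ring

lemma exists_diagonalization [DecidableEq ι] {S : Matrix ι ι ℝ} (hS : Sᵀ = S) :
    ∃ (U : Matrix ι ι ℝ) (d : ι → ℝ), U * Uᵀ = 1 ∧ Uᵀ * U = 1 ∧ Uᵀ * S * U = diagonal d := by
  have hH : S.IsHermitian := by
    rw [Matrix.IsHermitian, Matrix.conjTranspose_eq_transpose_of_trivial, hS]
  have h1 : (hH.eigenvectorUnitary : Matrix ι ι ℝ) * (hH.eigenvectorUnitary : Matrix ι ι ℝ)ᵀ = 1 := by
    have := Matrix.mem_unitaryGroup_iff.1 hH.eigenvectorUnitary.2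
    rwa [Matrix.star_eq_conjTranspose, Matrix.conjTranspose_eq_transpose_of_trivial] at this
  have h2 : (hH.eigenvectorUnitary : Matrix ι ι ℝ)ᵀ * (hH.eigenvectorUnitary : Matrix ι ι ℝ) = 1 := by
    have := Matrix.mem_unitaryGroup_iff'.1 hH.eigenvectorUnitary.2
    rwa [Matrix.star_eq_conjTranspose, Matrix.conjTranspose_eq_transpose_of_trivial] at this
  refine ⟨hH.eigenvectorUnitary, hH.eigenvalues, h1, h2, ?_⟩
  have h3 := hH.conjStarAlgAut_star_eigenvectorUnitary
  rw [Unitary.conjStarAlgAut_star_apply, Matrix.star_eq_conjTranspose,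
    Matrix.conjTranspose_eq_transpose_of_trivial] at h3
  simpa using h3

lemma conj_commutator [DecidableEq ι] (A B : Matrix ι ι ℝ) {U : Matrix ι τ ℝ}
    (hU : U * Uᵀ = 1) : Uᵀ * (A * B - B * A) * U =
      (Uᵀ * A * U) * (Uᵀ * B * U) - (Uᵀ * B * U) * (Uᵀ * A * U) := by
  have h (A B : Matrix ι ι ℝ) : (Uᵀ * A * U) * (Uᵀ * B * U) = Uᵀ * (A * B) * U := by
    calc _ = Uᵀ * A * (U * Uᵀ) * B * U := by simp only [Matrix.mul_assoc]
      _ = _ := by rw [hU]; simp only [Matrix.mul_assoc, Matrix.one_mul]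
  rw [h, h, Matrix.mul_sub, Matrix.sub_mul]

/-- The commutator of a symmetric and an arbitrary matrix only sees the symmetric matrix up to
multiples of the identity, and is bounded by twice the product of the norms. -/
lemma frobSq_commutator_symm_le [DecidableEq ι] {S : Matrix ι ι ℝ} (hS : Sᵀ = S)
    (L : Matrix ι ι ℝ) (c : ℝ) :
    frobSq (S * L - L * S) ≤ 2 * frobSq (S - c • (1 : Matrix ι ι ℝ)) * frobSq L := by
  obtain ⟨U, d, h1, h2, h3⟩ := exists_diagonalization hS
  rw [← frobSq_conj _ h1, conj_commutator _ _ h1, ← frobSq_conj (S - c • 1) h1,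
    ← frobSq_conj L h1, Matrix.mul_sub, Matrix.sub_mul, h3]
  simp only [Matrix.mul_smul, Matrix.mul_one, Matrix.smul_mul, h2]
  generalize Uᵀ * L * U = K
  have hd : frobSq (diagonal d - c • (1 : Matrix ι ι ℝ)) = ∑ i, (d i - c) ^ 2 := by
    unfold frobSq
    refine Finset.sum_congr rfl fun i _ => ?_
    rw [Finset.sum_eq_single i]
    · simp
    · intro j _ hj
      simp [Matrix.diagonal_apply_ne' _ hj, Matrix.one_apply_ne' hj]
    · simp
  rw [hd]
  unfold frobSq
  rw [Finset.mul_sum]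
  refine Finset.sum_le_sum fun i _ => ?_
  rw [Finset.mul_sum]
  refine Finset.sum_le_sum fun j _ => ?_
  rw [Matrix.sub_apply, Matrix.diagonal_mul, Matrix.mul_diagonal]
  -- In an eigenbasis of S the commutator multiplies the (i, j) entry by d_i - d_j; the factor 2 is
  -- (x - y)² ≤ 2(x² + y²).
  have hij : (d i - d j) ^ 2 ≤ 2 * ∑ i, (d i - c) ^ 2 := by
    by_cases h : i = j
    · subst h
      simpa using Finset.sum_nonneg fun i _ => sq_nonneg (d i - c)
    · have := Finset.add_le_sum (s := Finset.univ) (f := fun i => (d i - c) ^ 2)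
        (fun i _ => sq_nonneg _) (Finset.mem_univ i) (Finset.mem_univ j) h
      nlinarith [sq_nonneg (d i - c + (d j - c))]
  calc (d i * K i j - K i j * d j) ^ 2 = (d i - d j) ^ 2 * K i j ^ 2 := by ring
    _ ≤ _ := mul_le_mul_of_nonneg_right hij (sq_nonneg _)

/-- The largest eigenvalue of `Aᵀ A` and a unit eigenvector. -/
lemma exists_top_singular [Nonempty ι] (A : Matrix ι ι ℝ) :
    ∃ (μ : ℝ) (v : ι → ℝ), 0 ≤ μ ∧ v ⬝ᵥ v = 1 ∧ (Aᵀ * A) *ᵥ v = μ • v ∧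
      ∀ {τ : Type} [Fintype τ] (X : Matrix ι τ ℝ), frobSq (A * X) ≤ μ * frobSq X := by
  classical
  obtain ⟨U, d, h1, h2, h3⟩ := exists_diagonalization (S := Aᵀ * A) (by simp)
  obtain ⟨i₀, hi₀⟩ := Finite.exists_max d
  have h4 : Aᵀ * A * U = U * diagonal d := by
    rw [← h3, ← Matrix.mul_assoc, ← Matrix.mul_assoc, h1, Matrix.one_mul]
  have hv : U.col i₀ ⬝ᵥ U.col i₀ = 1 := by
    have := congrFun (congrFun h2 i₀) i₀
    simpa [Matrix.mul_apply, dotProduct] using this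
  have he : (Aᵀ * A) *ᵥ U.col i₀ = d i₀ • U.col i₀ := by
    have := congrArg (fun B => B.col i₀) h4
    ext i
    have := congrFun this i
    simp only [Matrix.col_apply, Matrix.mul_diagonal] at this
    rw [Pi.smul_apply, Matrix.col_apply, smul_eq_mul, mul_comm, ← this, Matrix.mul_apply]
    rfl
  refine ⟨d i₀, U.col i₀, ?_, hv, he, ?_⟩
  · have h5 : U.col i₀ ⬝ᵥ ((Aᵀ * A) *ᵥ U.col i₀) = d i₀ := by
      rw [he, dotProduct_smul, hv]; simp
    rw [← h5, ← Matrix.mulVec_mulVec, Matrix.dotProduct_mulVec, Matrix.vecMul_transpose]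
    exact Finset.sum_nonneg fun i _ => mul_self_nonneg _
  · intro τ _ X
    -- In the eigenbasis of AᵀA the squared norm of AX is a sum of squares weighted by the
    -- eigenvalues, so the largest one bounds it.
    have h5 : frobSq (A * X) = ((Uᵀ * X)ᵀ * diagonal d * (Uᵀ * X)).trace := by
      rw [frobSq_eq_trace, ← h3, Matrix.transpose_mul, Matrix.transpose_mul,
        Matrix.transpose_transpose]
      congr 1
      calc Xᵀ * Aᵀ * (A * X) = Xᵀ * (1 : Matrix ι ι ℝ) * Aᵀ * A * (1 : Matrix ι ι ℝ) * X := by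
            simp [Matrix.mul_assoc]
        _ = _ := by rw [← h1]; simp only [Matrix.mul_assoc]
    rw [h5, ← frobSq_transpose_mul_of_mul_transpose X h1]
    generalize Uᵀ * X = Y
    simp only [Matrix.trace, Matrix.diag, Matrix.mul_apply (M := Yᵀ * diagonal d),
      Matrix.mul_diagonal, Matrix.transpose_apply, frobSq]
    rw [Finset.sum_comm, Finset.mul_sum]
    refine Finset.sum_le_sum fun i _ => ?_
    rw [Finset.mul_sum]
    refine Finset.sum_le_sum fun j _ => ?_
    nlinarith [mul_le_mul_of_nonneg_right (hi₀ i) (sq_nonneg (Y i j))]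

/-- A nonzero skew-symmetric matrix splits off the plane of its top singular value. -/
lemma exists_skew_block [DecidableEq ι] {A : Matrix ι ι ℝ} (hA : Aᵀ = -A) (h0 : A ≠ 0) :
    ∃ (n : ℕ) (U : Matrix ι (Fin 2 ⊕ Fin n) ℝ) (s : ℝ) (A₂ : Matrix (Fin n) (Fin n) ℝ),
      U * Uᵀ = 1 ∧ Uᵀ * U = 1 ∧ A₂ᵀ = -A₂ ∧
      Uᵀ * A * U = fromBlocks !![0, -s; s, 0] 0 0 A₂ ∧
      ∀ {τ : Type} [Fintype τ] (X : Matrix ι τ ℝ), frobSq (A * X) ≤ s ^ 2 * frobSq X := by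
  have hne : Nonempty ι := by
    by_contra h
    rw [not_nonempty_iff] at h
    exact h0 (Subsingleton.elim _ _)
  obtain ⟨μ, v, hμ, hv, he, hX⟩ := exists_top_singular A
  have hμ0 : 0 < μ := by
    refine lt_of_le_of_ne hμ fun h => h0 ?_
    have h1 := hX (1 : Matrix ι ι ℝ)
    rw [← h, zero_mul, Matrix.mul_one] at h1
    exact eq_zero_of_frobSq_le_zero h1
  set s := √μ with hs
  have hs0 : 0 < s := Real.sqrt_pos.2 hμ0
  have hs2 : s ^ 2 = μ := Real.sq_sqrt hμ
  have hskew (x y : ι → ℝ) : x ⬝ᵥ (A *ᵥ y) = -((A *ᵥ x) ⬝ᵥ y) := by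
    rw [Matrix.dotProduct_mulVec, ← Matrix.mulVec_transpose, hA, Matrix.neg_mulVec, neg_dotProduct]
  -- The normalised image of v completes the plane: skewness makes w orthogonal to v, and A² v = -s²
  -- v gives A w = -s v, so A acts on the span as s times a quarter turn.
  set w : ι → ℝ := s⁻¹ • (A *ᵥ v) with hw
  have hAv : A *ᵥ v = s • w := by rw [hw, smul_smul, mul_inv_cancel₀ hs0.ne', one_smul]
  have hAAv : A *ᵥ (A *ᵥ v) = -(s ^ 2) • v := by
    have := he
    rw [hA, Matrix.neg_mul, Matrix.neg_mulVec, ← Matrix.mulVec_mulVec] at this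
    rw [neg_smul, hs2, ← this, neg_neg]
  have hAw : A *ᵥ w = -s • v := by
    rw [hw, Matrix.mulVec_smul, hAAv, smul_smul]
    congr 1
    field_simp
  have hvw : v ⬝ᵥ w = 0 := by
    have h1 := hskew v v
    rw [dotProduct_comm (A *ᵥ v) v] at h1
    rw [hw, dotProduct_smul, show v ⬝ᵥ (A *ᵥ v) = 0 by linarith, smul_zero]
  have hww : w ⬝ᵥ w = 1 := by
    have h1 : (A *ᵥ v) ⬝ᵥ (A *ᵥ v) = s ^ 2 := by
      rw [← neg_neg ((A *ᵥ v) ⬝ᵥ (A *ᵥ v)), ← hskew, hAAv, dotProduct_smul, hv]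
      simp
    rw [hw, dotProduct_smul, smul_dotProduct, h1, smul_eq_mul, smul_eq_mul]
    field_simp
  let g : Fin 2 → EuclideanSpace ℝ ι := ![WithLp.toLp 2 v, WithLp.toLp 2 w]
  have hin (x y : ι → ℝ) : inner ℝ (WithLp.toLp 2 x) (WithLp.toLp 2 y) = x ⬝ᵥ y := by
    simp [EuclideanSpace.inner_eq_star_dotProduct, dotProduct_comm]
  have hg : Orthonormal ℝ g := by
    rw [orthonormal_iff_ite]
    intro i j
    fin_cases i <;> fin_cases j <;>
      simp [g, -inner_self_eq_norm_sq_to_K, hin, hv, hvw, hww,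
        dotProduct_comm w v]
  have hcard : 2 ≤ Fintype.card ι := by
    simpa using hg.linearIndependent.fintype_card_le_finrank
  obtain ⟨b, hb⟩ := Orthonormal.exists_orthonormalBasis_extension_of_card_eq (𝕜 := ℝ)
    (E := EuclideanSpace ℝ ι) (ι := Fin 2 ⊕ Fin (Fintype.card ι - 2))
    (by simp; omega) (v := Sum.elim g 0) (s := Set.range Sum.inl) (by
      rw [orthonormal_iff_ite] at hg ⊢
      rintro ⟨_, i, rfl⟩ ⟨_, j, rfl⟩
      simpa [Set.domRestrict, Subtype.ext_iff] using hg i j)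
  let U : Matrix ι (Fin 2 ⊕ Fin (Fintype.card ι - 2)) ℝ := Matrix.of fun i k => b k i
  have hU2 : Uᵀ * U = 1 := by
    ext k l
    have := orthonormal_iff_ite.1 b.orthonormal k l
    rw [Matrix.one_apply, ← this, EuclideanSpace.inner_eq_star_dotProduct, Matrix.mul_apply,
      dotProduct]
    simp [U, mul_comm]
  have hU1 : U * Uᵀ = 1 := by
    have e : (Fin 2 ⊕ Fin (Fintype.card ι - 2)) ≃ ι := Fintype.equivOfCardEq (by simp; omega)
    exact (Matrix.mul_eq_one_comm_of_equiv e).1 hU2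
  have hc0 : ∀ i, (A * U) i (Sum.inl 0) = s * U i (Sum.inl 1) := by
    intro i
    have h0 := hb (Sum.inl 0) ⟨0, rfl⟩
    have h1 := hb (Sum.inl 1) ⟨1, rfl⟩
    have := congrFun hAv i
    simp only [Pi.smul_apply, smul_eq_mul] at this
    simp [Matrix.mul_apply, U, h0, h1, g, ← this, Matrix.mulVec, dotProduct]
  have hc1 : ∀ i, (A * U) i (Sum.inl 1) = -s * U i (Sum.inl 0) := by
    intro i
    have h0 := hb (Sum.inl 0) ⟨0, rfl⟩
    have h1 := hb (Sum.inl 1) ⟨1, rfl⟩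
    have := congrFun hAw i
    simp only [Pi.smul_apply, smul_eq_mul] at this
    simp only [Matrix.mul_apply, U, h0, h1, g, Matrix.of_apply, Sum.elim_inl]
    simpa [Matrix.mulVec, dotProduct] using this
  set A' := Uᵀ * A * U with hA'
  have hA'skew : A'ᵀ = -A' := by
    rw [hA', Matrix.transpose_mul, Matrix.transpose_mul, Matrix.transpose_transpose, hA,
      Matrix.neg_mul, Matrix.mul_neg, Matrix.mul_assoc]
  have hcol0 (k) : A' k (Sum.inl 0) = if k = Sum.inl 1 then s else 0 := by
    have := congrFun (congrFun hU2 k) (Sum.inl 1)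
    rw [Matrix.mul_apply, Matrix.one_apply] at this
    rw [hA', Matrix.mul_assoc, Matrix.mul_apply]
    simp only [hc0, mul_left_comm, ← Finset.mul_sum, this]
    simp
  have hcol1 (k) : A' k (Sum.inl 1) = if k = Sum.inl 0 then -s else 0 := by
    have := congrFun (congrFun hU2 k) (Sum.inl 0)
    rw [Matrix.mul_apply, Matrix.one_apply] at this
    rw [hA', Matrix.mul_assoc, Matrix.mul_apply]
    simp only [hc1, mul_left_comm, ← Finset.mul_sum, this]
    simp
  have hsk (k l) : A' k l = -A' l k := by
    have := congrFun (congrFun hA'skew l) k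
    simpa using this
  refine ⟨_, U, s, A'.toBlocks₂₂, hU1, hU2, ?_, ?_, fun X => by rw [hs2]; exact hX X⟩
  · ext i j
    simpa [Matrix.toBlocks₂₂] using hsk (Sum.inr j) (Sum.inr i)
  -- The first two columns are known; skewness then fixes the first two rows.
  · refine (Matrix.fromBlocks_toBlocks A').symm.trans ?_
    congr 1
    · ext i j
      fin_cases i <;> fin_cases j <;> simp [Matrix.toBlocks₁₁, hcol0, hcol1]
    · ext i j
      simp only [Matrix.toBlocks₁₂, Matrix.of_apply, Matrix.zero_apply]
      rw [hsk]
      fin_cases i <;> simp [hcol0, hcol1]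
    · ext i j
      fin_cases j <;> simp [Matrix.toBlocks₂₁, hcol0, hcol1]

lemma frobSq_zero : frobSq (0 : Matrix ι κ ℝ) = 0 := by
  simp [frobSq]

lemma frobSq_rotation (s : ℝ) : frobSq !![0, -s; s, 0] = 2 * s ^ 2 := by
  simp [frobSq, Fin.sum_univ_two]
  ring

lemma frobSq_rotation_mul (s : ℝ) (X : Matrix (Fin 2) ι ℝ) :
    frobSq (!![0, -s; s, 0] * X) = s ^ 2 * frobSq X := by
  simp only [frobSq, Fin.sum_univ_two, Matrix.mul_apply, Finset.mul_sum, mul_add,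
    ← Finset.sum_add_distrib]
  refine Finset.sum_congr rfl fun i _ => ?_
  simp
  ring

lemma frobSq_mul_rotation (s : ℝ) (X : Matrix ι (Fin 2) ℝ) :
    frobSq (X * !![0, -s; s, 0]) = s ^ 2 * frobSq X := by
  simp only [frobSq, Fin.sum_univ_two, Matrix.mul_apply, Finset.mul_sum]
  refine Finset.sum_congr rfl fun i _ => ?_
  simp
  ring

lemma frobSq_mul_skew {A : Matrix κ κ ℝ} (hA : Aᵀ = -A) (X : Matrix ι κ ℝ) :
    frobSq (X * A) = frobSq (A * Xᵀ) := by
  rw [← frobSq_transpose, Matrix.transpose_mul, hA, Matrix.neg_mul, frobSq_neg]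

/-- The top singular value of a nonzero skew matrix occurs on a plane, hence counts twice in the
Frobenius norm. This doubling is what makes the skew commutator bound sharper than the general one.
-/
lemma exists_skew_bound {n : ℕ} {A : Matrix (Fin n) (Fin n) ℝ} (hA : Aᵀ = -A) :
    ∃ ν : ℝ, 0 ≤ ν ∧ 2 * ν ≤ frobSq A ∧
      ∀ {τ : Type} [Fintype τ] (X : Matrix (Fin n) τ ℝ), frobSq (A * X) ≤ ν * frobSq X := by
  by_cases h0 : A = 0
  · refine ⟨0, le_rfl, by simpa using frobSq_nonneg A, fun X => ?_⟩
    simp [h0, frobSq]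
  obtain ⟨k, U, s, A₂, hU1, hU2, hA₂, hb, hX⟩ := exists_skew_block hA h0
  refine ⟨s ^ 2, sq_nonneg s, ?_, hX⟩
  rw [← frobSq_conj A hU1, hb, frobSq_fromBlocks]
  rw [frobSq_rotation, frobSq_zero, frobSq_zero]
  linarith [frobSq_nonneg A₂]

/-- The commutator of two skew-symmetric matrices is bounded by the product of their norms. -/
lemma frobSq_commutator_skew_le [DecidableEq ι] {A B : Matrix ι ι ℝ} (hA : Aᵀ = -A)
    (hB : Bᵀ = -B) : frobSq (A * B - B * A) ≤ frobSq A * frobSq B := by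
  by_cases h0 : A = 0
  · simp [h0, frobSq]
  obtain ⟨n, U, s, A₂, hU1, hU2, hA₂, hb, hX⟩ := exists_skew_block hA h0
  obtain ⟨ν, hν, hν2, hνX⟩ := exists_skew_bound hA₂
  -- The complementary block inherits the bound s² by padding X with two zero rows.
  have hX₂ {τ : Type} [Fintype τ] (X : Matrix (Fin n) τ ℝ) :
      frobSq (A₂ * X) ≤ s ^ 2 * frobSq X := by
    have h1 := hX (U * fromRows (0 : Matrix (Fin 2) τ ℝ) X)
    have hU3 : Uᵀ * Uᵀᵀ = 1 := by rwa [Matrix.transpose_transpose]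
    have h2 (Y : Matrix (Fin 2 ⊕ Fin n) τ ℝ) : frobSq (U * Y) = frobSq Y :=
      frobSq_transpose_mul_of_mul_transpose Y hU3
    have h3 : A * (U * fromRows (0 : Matrix (Fin 2) τ ℝ) X) =
        U * ((Uᵀ * A * U) * fromRows (0 : Matrix (Fin 2) τ ℝ) X) := by
      calc _ = (1 : Matrix ι ι ℝ) * A * U * fromRows (0 : Matrix (Fin 2) τ ℝ) X := by
            simp only [Matrix.mul_assoc, Matrix.one_mul]
        _ = _ := by rw [← hU1]; simp only [Matrix.mul_assoc]
    have h4 (Y : Matrix (Fin n) τ ℝ) : frobSq (fromRows (0 : Matrix (Fin 2) τ ℝ) Y) = frobSq Y := by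
      simp [frobSq]
    rw [h3, h2, h2, hb, Matrix.fromBlocks_mul_fromRows] at h1
    simpa [h4] using h1
  rw [← frobSq_conj _ hU1, conj_commutator _ _ hU1, ← frobSq_conj A hU1, ← frobSq_conj B hU1, hb]
  have hBs : (Uᵀ * B * U)ᵀ = -(Uᵀ * B * U) := by
    rw [Matrix.transpose_mul, Matrix.transpose_mul, Matrix.transpose_transpose, hB,
      Matrix.neg_mul, Matrix.mul_neg, Matrix.mul_assoc]
  generalize Uᵀ * B * U = K at hBs
  obtain ⟨P, Q, R, W, rfl⟩ : ∃ P Q R W, K = fromBlocks P Q R W :=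
    ⟨_, _, _, _, (Matrix.fromBlocks_toBlocks K).symm⟩
  rw [Matrix.fromBlocks_transpose, Matrix.fromBlocks_neg, Matrix.fromBlocks_inj] at hBs
  obtain ⟨hP, hR, -, hW⟩ := hBs
  have hRQ : frobSq R = frobSq Q := by rw [← frobSq_transpose, hR, frobSq_neg]
  -- Skew 2 × 2 matrices commute, so the diagonal corner of the commutator vanishes.
  have hP0 : !![0, -s; s, 0] * P - P * !![0, -s; s, 0] = 0 := by
    have h00 := congrFun (congrFun hP 0) 0
    have h11 := congrFun (congrFun hP 1) 1
    have h01 := congrFun (congrFun hP 0) 1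
    simp only [Matrix.transpose_apply, Matrix.neg_apply] at h00 h11 h01
    have h00' : P 0 0 = 0 := by linarith
    have h11' : P 1 1 = 0 := by linarith
    ext i j
    fin_cases i <;> fin_cases j <;>
      simp [Matrix.mul_apply, Matrix.vecMul, dotProduct, Fin.sum_univ_two, h00', h11', h01] <;>
      ring
  have hQ1 : frobSq (!![0, -s; s, 0] * Q - Q * A₂) ≤ 2 * (s ^ 2 + ν) * frobSq Q := by
    have h1 := frobSq_sub_le (!![0, -s; s, 0] * Q) (Q * A₂)
    rw [frobSq_rotation_mul, frobSq_mul_skew hA₂] at h1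
    have h2 := hνX Qᵀ
    rw [frobSq_transpose] at h2
    linarith
  have hR1 : frobSq (A₂ * R - R * !![0, -s; s, 0]) ≤ 2 * (s ^ 2 + ν) * frobSq Q := by
    have h1 := frobSq_sub_le (A₂ * R) (R * !![0, -s; s, 0])
    rw [frobSq_mul_rotation, hRQ] at h1
    have h2 := hνX R
    rw [hRQ] at h2
    linarith
  -- Both products are bounded by ν|W|² and also by s²|W|²; averaging the two bounds yields the same
  -- constant as for the off-diagonal blocks.
  have hW1 : frobSq (A₂ * W - W * A₂) ≤ 2 * (s ^ 2 + ν) * frobSq W := by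
    have h1 := frobSq_sub_le (A₂ * W) (W * A₂)
    rw [frobSq_mul_skew hA₂] at h1
    have h2 := hνX Wᵀ
    have h3 := hX₂ Wᵀ
    rw [frobSq_transpose] at h2 h3
    linarith [hνX W, hX₂ W]
  have hsub : fromBlocks !![0, -s; s, 0] 0 0 A₂ * fromBlocks P Q R W -
      fromBlocks P Q R W * fromBlocks !![0, -s; s, 0] 0 0 A₂ =
      fromBlocks 0 (!![0, -s; s, 0] * Q - Q * A₂) (A₂ * R - R * !![0, -s; s, 0])
        (A₂ * W - W * A₂) := by
    rw [Matrix.fromBlocks_multiply, Matrix.fromBlocks_multiply, sub_eq_add_neg,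
      Matrix.fromBlocks_neg, Matrix.fromBlocks_add, ← hP0]
    simp [sub_eq_add_neg]
  rw [hsub]
  simp only [frobSq_fromBlocks, frobSq_zero, frobSq_rotation, hRQ]
  -- Here 2ν ≤ |A₂|² turns 2(s² + ν) into at most |A|².
  have hN : 2 * (s ^ 2 + ν) * (2 * frobSq Q + frobSq W) ≤
      (2 * s ^ 2 + frobSq A₂) * (2 * frobSq Q + frobSq W) :=
    mul_le_mul_of_nonneg_right (by linarith)
      (by linarith [frobSq_nonneg Q, frobSq_nonneg W])
  have hN2 : 0 ≤ (2 * s ^ 2 + frobSq A₂) * frobSq P :=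
    mul_nonneg (by linarith [sq_nonneg s, frobSq_nonneg A₂]) (frobSq_nonneg P)
  linarith

end Frobenius

/-! ### The quadratic form of Γ as a weighted sum of squares -/

section Weitzenboeck

variable {ι : Type} [Fintype ι] {q : ℕ}

/-- The quadratic form `⟨ΓQ, Q⟩` in components with respect to an orthonormal frame. -/
def lichnerowiczForm (r : ι → ι → ι → ι → ℝ) (Q : (Fin q → ι) → ℝ) : ℝ :=
  ∑ i, ((∑ l, ∑ a, (∑ k, r k (i l) k a) * Q (Function.update i l a))
    - ∑ l, ∑ h, if l = h then 0 else ∑ a, ∑ b, r (i l) a (i h) b *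
        Q (Function.update (Function.update i l a) h b)) * Q i

/-- The derivation action of a matrix on a covariant tensor, in components. -/
def derivAction (ψ : Matrix ι ι ℝ) (Q : (Fin q → ι) → ℝ) (i : Fin q → ι) : ℝ :=
  ∑ l, ∑ p, ψ p (i l) * Q (Function.update i l p)

/-- Exchanging the h-th entry of the multi-index with the free index is an involution. It serves to
move an index substitution off one of the two factors of Q. -/
lemma sum_update_swap (h : Fin q) (F : (Fin q → ι) → ι → ℝ) :
    ∑ i, ∑ b, F i b = ∑ i, ∑ b, F (Function.update i h b) (i h) := by
  have hinv : Function.Involutive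
      (fun x : (Fin q → ι) × ι => (Function.update x.1 h x.2, x.1 h)) := by
    rintro ⟨i, b⟩
    simp
  rw [← Fintype.sum_prod_type', ← Fintype.sum_prod_type']
  exact (Equiv.sum_comp hinv.toPerm fun x => F x.1 x.2).symm

lemma sum_derivAction_sq (ψ : Matrix ι ι ℝ) (Q : (Fin q → ι) → ℝ) :
    ∑ i, derivAction ψ Q i ^ 2 = ∑ l, ∑ h, ∑ i, ∑ a, ∑ b, ψ a (i l) * ψ b (i h) *
      (Q (Function.update i l a) * Q (Function.update i h b)) := by
  have h1 (i : Fin q → ι) : derivAction ψ Q i ^ 2 = ∑ l, ∑ h, ∑ a, ∑ b, ψ a (i l) * ψ b (i h) *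
      (Q (Function.update i l a) * Q (Function.update i h b)) := by
    rw [derivAction, sq, Finset.sum_mul_sum]
    refine Finset.sum_congr rfl fun l _ => Finset.sum_congr rfl fun h _ => ?_
    rw [Finset.sum_mul_sum]
    exact Finset.sum_congr rfl fun a _ => Finset.sum_congr rfl fun b _ => by ring
  simp only [h1]
  rw [Finset.sum_comm]
  exact Finset.sum_congr rfl fun l _ => Finset.sum_comm

/-- If the curvature tensor is diagonalised by skew-symmetric `ψ`, then `⟨ΓQ, Q⟩` is the sum of
the squared norms of the derivations of `Q` by the `ψ`, weighted by the eigenvalues. -/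
lemma lichnerowiczForm_eq_sum [DecidableEq ι] {A : Type*} [Fintype A] {r : ι → ι → ι → ι → ℝ} {lam : A → ℝ}
    {ψ : A → Matrix ι ι ℝ} (hψ : ∀ α a b, ψ α a b = -ψ α b a)
    (hr : ∀ a b c d, r a b c d = ∑ α, lam α * (ψ α a b * ψ α c d)) (Q : (Fin q → ι) → ℝ) :
    lichnerowiczForm r Q = ∑ α, lam α * ∑ i, derivAction (ψ α) Q i ^ 2 := by
  have hr12 (a b c d : ι) : r a b c d = -r b a c d := by
    rw [hr, hr, ← Finset.sum_neg_distrib]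
    exact Finset.sum_congr rfl fun α _ => by rw [hψ α a b]; ring
  have hr34 (a b c d : ι) : r a b c d = -r a b d c := by
    rw [hr, hr, ← Finset.sum_neg_distrib]
    exact Finset.sum_congr rfl fun α _ => by rw [hψ α c d]; ring
  have hrp (a b c d : ι) : r a b c d = r c d a b := by
    rw [hr, hr]
    exact Finset.sum_congr rfl fun α _ => by ring
  have hR : ∑ α, lam α * ∑ i, derivAction (ψ α) Q i ^ 2 =
      ∑ l, ∑ h, ∑ i, ∑ a, ∑ b, r a (i l) b (i h) *
        (Q (Function.update i l a) * Q (Function.update i h b)) := by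
    simp only [sum_derivAction_sq, hr, Finset.mul_sum, Finset.sum_mul]
    rw [Finset.sum_comm]
    refine Finset.sum_congr rfl fun l _ => ?_
    rw [Finset.sum_comm]
    refine Finset.sum_congr rfl fun h _ => ?_
    rw [Finset.sum_comm]
    refine Finset.sum_congr rfl fun i _ => ?_
    rw [Finset.sum_comm]
    refine Finset.sum_congr rfl fun a _ => ?_
    rw [Finset.sum_comm]
    exact Finset.sum_congr rfl fun b _ => Finset.sum_congr rfl fun α _ => by ring
  have hL : lichnerowiczForm r Q = ∑ l, ∑ h, ∑ i : Fin q → ι, if l = h then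
      ∑ a, (∑ k, r k (i l) k a) * Q (Function.update i l a) * Q i else
      -∑ a, ∑ b, r (i l) a (i h) b *
        Q (Function.update (Function.update i l a) h b) * Q i := by
    unfold lichnerowiczForm
    simp only [sub_mul]
    simp only [← Finset.sum_comm (s := (Finset.univ : Finset (Fin q → ι)))]
    refine Finset.sum_congr rfl fun i _ => ?_
    rw [Finset.sum_mul, Finset.sum_mul, ← Finset.sum_sub_distrib]
    refine Finset.sum_congr rfl fun l _ => ?_
    have key (X : ℝ) (Y : Fin q → ℝ) : X * Q i - (∑ h, Y h) * Q i =
        ∑ h, ((if l = h then X * Q i else 0) - Y h * Q i) := by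
      rw [Finset.sum_sub_distrib, Finset.sum_mul]
      simp
    rw [key]
    refine Finset.sum_congr rfl fun h _ => ?_
    split_ifs
    · simp [Finset.sum_mul]
    · simp [Finset.sum_mul]
  rw [hL, hR]
  refine Finset.sum_congr rfl fun l _ => Finset.sum_congr rfl fun h _ => ?_
  -- Diagonal pairs of slots contract to the Ricci term; distinct slots give the curvature term, its
  -- minus sign coming from skewness in the first pair.
  by_cases hlh : l = h
  · subst hlh
    simp only [if_true]
    have h1 (i : Fin q → ι) : ∑ a, ∑ b, r a (i l) b (i l) *
        (Q (Function.update i l a) * Q (Function.update i l b)) =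
        ∑ b, ∑ a, r a (i l) b (i l) *
        (Q (Function.update i l a) * Q (Function.update i l b)) := Finset.sum_comm
    simp only [h1]
    refine Eq.trans ?_ (sum_update_swap l _).symm
    refine Finset.sum_congr rfl fun i _ => ?_
    refine Eq.trans ?_ Finset.sum_comm
    refine Finset.sum_congr rfl fun a _ => ?_
    simp only [Function.update_self, Function.update_idem, Function.update_eq_self,
      Finset.sum_mul]
    refine Finset.sum_congr rfl fun k _ => ?_
    rw [hr12 a k, hr34 k a, hrp k a k]
    ring
  · simp only [if_neg hlh]
    have h1 (i : Fin q → ι) : ∑ a, ∑ b, r a (i l) b (i h) *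
        (Q (Function.update i l a) * Q (Function.update i h b)) =
        ∑ b, ∑ a, r a (i l) b (i h) *
        (Q (Function.update i l a) * Q (Function.update i h b)) := Finset.sum_comm
    simp only [h1]
    refine Eq.trans ?_ (sum_update_swap h _).symm
    refine Finset.sum_congr rfl fun i _ => ?_
    rw [← Finset.sum_neg_distrib]
    refine Eq.trans ?_ Finset.sum_comm
    refine Finset.sum_congr rfl fun a _ => ?_
    rw [← Finset.sum_neg_distrib]
    refine Finset.sum_congr rfl fun b _ => ?_
    simp only [Function.update_self, Function.update_idem, Function.update_eq_self,
      Function.update_of_ne hlh]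
    rw [hr12 (i l) a, Function.update_comm (Ne.symm hlh)]
    ring

end Weitzenboeck

/-! ### Kulkarni–Nomizu products and derivations in components -/

section Components

variable {ι : Type} [Fintype ι]

/-- The sum of a function of four indices. -/
def sum4 (F : ι → ι → ι → ι → ℝ) : ℝ := ∑ a, ∑ b, ∑ c, ∑ d, F a b c d

lemma sum4_congr {F G : ι → ι → ι → ι → ℝ} (h : ∀ a b c d, F a b c d = G a b c d) :
    sum4 F = sum4 G := by simp only [sum4, h]

lemma sum4_le {F G : ι → ι → ι → ι → ℝ} (h : ∀ a b c d, F a b c d ≤ G a b c d) :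
    sum4 F ≤ sum4 G :=
  Finset.sum_le_sum fun a _ => Finset.sum_le_sum fun b _ => Finset.sum_le_sum fun c _ =>
    Finset.sum_le_sum fun d _ => h a b c d

lemma sum4_add (F G : ι → ι → ι → ι → ℝ) :
    sum4 (fun a b c d => F a b c d + G a b c d) = sum4 F + sum4 G := by
  simp only [sum4, Finset.sum_add_distrib]

lemma sum4_sub (F G : ι → ι → ι → ι → ℝ) :
    sum4 (fun a b c d => F a b c d - G a b c d) = sum4 F - sum4 G := by
  simp only [sum4, Finset.sum_sub_distrib]

lemma sum4_const_mul (k : ℝ) (F : ι → ι → ι → ι → ℝ) :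
    sum4 (fun a b c d => k * F a b c d) = k * sum4 F := by
  simp only [sum4, Finset.mul_sum]

lemma sum4_swap12 (F : ι → ι → ι → ι → ℝ) : sum4 F = sum4 fun a b c d => F b a c d :=
  Finset.sum_comm

lemma sum4_swap23 (F : ι → ι → ι → ι → ℝ) : sum4 F = sum4 fun a b c d => F a c b d :=
  Finset.sum_congr rfl fun _ _ => Finset.sum_comm

lemma sum4_swap34 (F : ι → ι → ι → ι → ℝ) : sum4 F = sum4 fun a b c d => F a b d c :=
  Finset.sum_congr rfl fun _ _ => Finset.sum_congr rfl fun _ _ => Finset.sum_comm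

lemma sum4_swap_pairs (F : ι → ι → ι → ι → ℝ) : sum4 F = sum4 fun a b c d => F c d a b := by
  rw [sum4_swap23, sum4_swap12, sum4_swap34, sum4_swap23]

lemma sum4_delta13 [DecidableEq ι] (F : ι → ι → ι → ι → ℝ) :
    sum4 (fun a b c d => if a = c then F a b c d else 0) = ∑ b, ∑ d, ∑ a, F a b a d := by
  simp only [sum4]
  rw [Finset.sum_comm]
  refine Finset.sum_congr rfl fun b _ => ?_
  rw [Finset.sum_comm (s := Finset.univ (α := ι)) (t := Finset.univ (α := ι))
    (f := fun d a => F a b a d)]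
  refine Finset.sum_congr rfl fun a _ => ?_
  rw [Finset.sum_comm]
  refine Finset.sum_congr rfl fun d _ => ?_
  simp

/-- A `4`-covariant tensor that is skew-symmetric in its first and in its last two arguments. -/
def IsPairSkew (u : ι → ι → ι → ι → ℝ) : Prop :=
  ∀ a b c d, u a b c d = -u b a c d ∧ u a b c d = -u a b d c

/-- The Ricci contraction in components. -/
def ric (u : ι → ι → ι → ι → ℝ) : Matrix ι ι ℝ := Matrix.of fun b d => ∑ a, u a b a d

/-- The Kulkarni–Nomizu product with the metric, in an orthonormal frame. -/
def kn [DecidableEq ι] (S : Matrix ι ι ℝ) (a b c d : ι) : ℝ :=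
  (if b = d then S a c else 0) + (if a = c then S b d else 0)
    - (if b = c then S a d else 0) - (if a = d then S b c else 0)

/-- The derivation action of a matrix on a `4`-covariant tensor. -/
def act (ψ : Matrix ι ι ℝ) (u : ι → ι → ι → ι → ℝ) (a b c d : ι) : ℝ :=
  ∑ p, (ψ p a * u p b c d + ψ p b * u a p c d + ψ p c * u a b p d + ψ p d * u a b c p)

/-- The Frobenius inner product of real matrices. -/
def frobInner (A B : Matrix ι ι ℝ) : ℝ := ∑ a, ∑ b, A a b * B a b

lemma frobInner_self (A : Matrix ι ι ℝ) : frobInner A A = frobSq A := by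
  simp only [frobInner, frobSq, sq]

/-- Up to the factor 4, the Ricci contraction is adjoint to the product with the metric: by pair
skewness the four terms contribute equally. -/
lemma sum4_mul_kn [DecidableEq ι] {u : ι → ι → ι → ι → ℝ} (hu : IsPairSkew u)
    (S : Matrix ι ι ℝ) :
    sum4 (fun a b c d => u a b c d * kn S a b c d) = 4 * frobInner (ric u) S := by
  have h13 : sum4 (fun a b c d => if a = c then u a b c d * S b d else 0) =
      frobInner (ric u) S := by
    rw [sum4_delta13]
    simp only [frobInner, ric, Matrix.of_apply, Finset.sum_mul]
  have h24 : sum4 (fun a b c d => if b = d then u a b c d * S a c else 0) =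
      frobInner (ric u) S := by
    rw [sum4_swap12, sum4_swap34, ← h13]
    refine sum4_congr fun a b c d => ?_
    rw [(hu b a d c).1, (hu a b d c).2, neg_neg]
  have h14 : sum4 (fun a b c d => if a = d then u a b c d * S b c else 0) =
      -frobInner (ric u) S := by
    rw [sum4_swap34, ← neg_eq_iff_eq_neg, ← h13, ← neg_one_mul, ← sum4_const_mul]
    refine sum4_congr fun a b c d => ?_
    rw [(hu a b d c).2]
    split_ifs <;> ring
  have h23 : sum4 (fun a b c d => if b = c then u a b c d * S a d else 0) =
      -frobInner (ric u) S := by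
    rw [sum4_swap12, ← neg_eq_iff_eq_neg, ← h13, ← neg_one_mul, ← sum4_const_mul]
    refine sum4_congr fun a b c d => ?_
    rw [(hu b a c d).1]
    split_ifs <;> ring
  simp only [kn, mul_add, mul_sub, mul_ite, mul_zero, sum4_add, sum4_sub, h13, h24, h14, h23]
  ring

lemma isPairSkew_kn {ι : Type} [DecidableEq ι] (S : Matrix ι ι ℝ) : IsPairSkew (kn S) := by
  intro a b c d
  unfold kn
  constructor <;> ring

lemma ric_kn [DecidableEq ι] (S : Matrix ι ι ℝ) :
    ric (kn S) = ((Fintype.card ι : ℝ) - 2) • S + S.trace • (1 : Matrix ι ι ℝ) := by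
  ext b d
  simp only [ric, kn, Matrix.of_apply, Finset.sum_add_distrib, Finset.sum_sub_distrib,
    Matrix.add_apply, Matrix.smul_apply, Matrix.one_apply, smul_eq_mul]
  simp [Finset.sum_ite_irrel, Matrix.trace]
  ring

lemma frobInner_add_smul_one [DecidableEq ι] (k l : ℝ) (S T : Matrix ι ι ℝ) :
    frobInner (k • S + l • (1 : Matrix ι ι ℝ)) T = k * frobInner S T + l * T.trace := by
  simp only [frobInner, Matrix.add_apply, Matrix.smul_apply, smul_eq_mul, add_mul,
    Finset.sum_add_distrib, Finset.mul_sum, Matrix.trace]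
  simp [Matrix.one_apply, mul_assoc]

lemma sum4_kn_sq [DecidableEq ι] (S : Matrix ι ι ℝ) :
    sum4 (fun a b c d => kn S a b c d ^ 2) =
      4 * (((Fintype.card ι : ℝ) - 2) * frobSq S + S.trace ^ 2) := by
  simp only [sq (kn S _ _ _ _)]
  rw [sum4_mul_kn (isPairSkew_kn S), ric_kn, frobInner_add_smul_one, frobInner_self, sq]

lemma sum4_sub_kn_sq [DecidableEq ι] {u : ι → ι → ι → ι → ℝ} (hu : IsPairSkew u)
    (S : Matrix ι ι ℝ) :
    sum4 (fun a b c d => (u a b c d - kn S a b c d) ^ 2) =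
      sum4 (fun a b c d => u a b c d ^ 2) - 8 * frobInner (ric u) S
        + 4 * (((Fintype.card ι : ℝ) - 2) * frobSq S + S.trace ^ 2) := by
  rw [← sum4_kn_sq, show (8 : ℝ) * frobInner (ric u) S = 2 * (4 * frobInner (ric u) S) by ring,
    ← sum4_mul_kn hu, ← sum4_const_mul, ← sum4_sub, ← sum4_add]
  exact sum4_congr fun a b c d => by ring

lemma isPairSkew_act {u : ι → ι → ι → ι → ℝ} (hu : IsPairSkew u) (ψ : Matrix ι ι ℝ) :
    IsPairSkew (act ψ u) := by
  intro a b c d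
  simp only [act, ← Finset.sum_neg_distrib]
  constructor <;> refine Finset.sum_congr rfl fun p _ => ?_
  · rw [(hu p b c d).1, (hu a p c d).1, (hu a b p d).1, (hu a b c p).1]
    ring
  · rw [(hu p b c d).2, (hu a p c d).2, (hu a b p d).2, (hu a b c p).2]
    ring

/-- A skew matrix annihilates the metric as a derivation, so it passes through the product and acts
on S alone, as a commutator. -/
lemma act_sub_kn [DecidableEq ι] {ψ : Matrix ι ι ℝ} (hψ : ψ.transpose = -ψ)
    (u : ι → ι → ι → ι → ℝ) (S : Matrix ι ι ℝ) (a b c d : ι) :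
    act ψ (fun a b c d => u a b c d - kn S a b c d) a b c d =
      act ψ u a b c d - kn (S * ψ - ψ * S) a b c d := by
  have hsk (i j : ι) : ψ i j = -ψ j i := by
    simpa using congrFun (congrFun hψ j) i
  have h : act ψ (kn S) a b c d = kn (S * ψ - ψ * S) a b c d := by
    have h1 (i j : ι) : (S * ψ - ψ * S) i j = ∑ p, (ψ p i * S p j + ψ p j * S i p) := by
      rw [Matrix.sub_apply, Matrix.mul_apply, Matrix.mul_apply, ← Finset.sum_sub_distrib]
      refine Finset.sum_congr rfl fun p _ => ?_
      rw [hsk i p]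
      ring
    simp only [act, kn, h1, mul_add, mul_sub, mul_ite, mul_zero, Finset.sum_add_distrib,
      Finset.sum_sub_distrib, Finset.sum_ite_irrel, Finset.sum_ite_eq, Finset.sum_ite_eq',
      Finset.mem_univ, if_true, Finset.sum_const_zero]
    rw [hsk b d, hsk a c, hsk b c, hsk a d]
    split_ifs <;> ring
  rw [← h]
  simp only [act, ← Finset.sum_sub_distrib]
  exact Finset.sum_congr rfl fun p _ => by ring

/-- For the same reason the derivation commutes with contraction: the two terms acting on the
contracted indices cancel. -/
lemma ric_act {ψ : Matrix ι ι ℝ} (hψ : ψ.transpose = -ψ) (u : ι → ι → ι → ι → ℝ) :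
    ric (act ψ u) = ric u * ψ - ψ * ric u := by
  have hsk (i j : ι) : ψ i j = -ψ j i := by
    simpa using congrFun (congrFun hψ j) i
  ext b d
  have h1 : ∑ a, ∑ p, ψ p a * u p b a d = -∑ a, ∑ p, ψ p a * u a b p d := by
    rw [Finset.sum_comm, ← Finset.sum_neg_distrib]
    refine Finset.sum_congr rfl fun a _ => ?_
    rw [← Finset.sum_neg_distrib]
    refine Finset.sum_congr rfl fun p _ => ?_
    rw [hsk a p]
    ring
  simp only [ric, act, Matrix.of_apply, Matrix.sub_apply, Matrix.mul_apply,
    Finset.sum_add_distrib, h1, Finset.sum_mul, Finset.mul_sum]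
  rw [Finset.sum_comm (f := fun a p => ψ p b * u a p a d),
    Finset.sum_comm (f := fun a p => ψ p d * u a b a p)]
  simp only [hsk b, mul_comm (ψ _ d)]
  simp
  ring

end Components

/-! ### Bound for one derivation, and the total over all derivations -/

section Estimates

variable {ι : Type} [Fintype ι]

/-- The action is a commutator in the first pair of indices plus one in the last pair. The skew
commutator bound applies to each slice, and (x + y)² ≤ 2x² + 2y² makes the constant 4. -/
lemma sum4_act_sq_le_of_isPairSkew [DecidableEq ι] {ψ : Matrix ι ι ℝ} (hψ : ψ.transpose = -ψ)
    {u : ι → ι → ι → ι → ℝ} (hu : IsPairSkew u) :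
    sum4 (fun a b c d => act ψ u a b c d ^ 2) ≤
      4 * frobSq ψ * sum4 (fun a b c d => u a b c d ^ 2) := by
  have hsk (i j : ι) : ψ i j = -ψ j i := by
    simpa using congrFun (congrFun hψ j) i
  let L (c d : ι) : Matrix ι ι ℝ := Matrix.of fun a b => u a b c d
  let R (a b : ι) : Matrix ι ι ℝ := Matrix.of fun c d => u a b c d
  have hL (c d : ι) : (L c d).transpose = -L c d := by
    ext a b
    simpa [L] using (hu b a c d).1
  have hR (a b : ι) : (R a b).transpose = -R a b := by
    ext c d
    simpa [R] using (hu a b d c).2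
  have hact (a b c d : ι) : act ψ u a b c d =
      (L c d * ψ - ψ * L c d) a b + (R a b * ψ - ψ * R a b) c d := by
    simp only [act, L, R, Matrix.sub_apply, Matrix.mul_apply, Matrix.of_apply,
      ← Finset.sum_sub_distrib, ← Finset.sum_add_distrib]
    refine Finset.sum_congr rfl fun p _ => ?_
    rw [hsk a p, hsk c p]
    ring
  have h1 : sum4 (fun a b c d => (L c d * ψ - ψ * L c d) a b ^ 2) ≤
      frobSq ψ * sum4 (fun a b c d => u a b c d ^ 2) := by
    rw [sum4_swap_pairs, sum4_swap_pairs fun a b c d => u a b c d ^ 2]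
    unfold sum4
    rw [Finset.mul_sum]
    refine Finset.sum_le_sum fun c _ => ?_
    rw [Finset.mul_sum]
    refine Finset.sum_le_sum fun d _ => ?_
    rw [mul_comm]
    exact frobSq_commutator_skew_le (hL c d) hψ
  have h2 : sum4 (fun a b c d => (R a b * ψ - ψ * R a b) c d ^ 2) ≤
      frobSq ψ * sum4 (fun a b c d => u a b c d ^ 2) := by
    unfold sum4
    rw [Finset.mul_sum]
    refine Finset.sum_le_sum fun a _ => ?_
    rw [Finset.mul_sum]
    refine Finset.sum_le_sum fun b _ => ?_
    rw [mul_comm]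
    exact frobSq_commutator_skew_le (hR a b) hψ
  calc sum4 (fun a b c d => act ψ u a b c d ^ 2)
      ≤ sum4 (fun a b c d => 2 * (L c d * ψ - ψ * L c d) a b ^ 2 +
          2 * (R a b * ψ - ψ * R a b) c d ^ 2) := by
        refine sum4_le fun a b c d => ?_
        rw [hact]
        nlinarith [sq_nonneg ((L c d * ψ - ψ * L c d) a b - (R a b * ψ - ψ * R a b) c d)]
    _ ≤ _ := by
        rw [sum4_add, sum4_const_mul, sum4_const_mul]
        linarith

lemma frobInner_smul_left (k : ℝ) (A B : Matrix ι ι ℝ) :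
    frobInner (k • A) B = k * frobInner A B := by
  simp only [frobInner, Matrix.smul_apply, smul_eq_mul, Finset.mul_sum, mul_assoc]

lemma frobSq_smul_add_smul_one [DecidableEq ι] (k l : ℝ) (S : Matrix ι ι ℝ) :
    frobSq (k • S + l • (1 : Matrix ι ι ℝ)) =
      k ^ 2 * frobSq S + 2 * k * l * S.trace + l ^ 2 * Fintype.card ι := by
  have h : frobInner S (k • S + l • (1 : Matrix ι ι ℝ)) = k * frobSq S + l * S.trace := by
    rw [← frobInner_self, ← frobInner_add_smul_one]
    simp only [frobInner, mul_comm]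
  rw [← frobInner_self, frobInner_add_smul_one, h, Matrix.trace_add, Matrix.trace_smul,
    Matrix.trace_smul, Matrix.trace_one, smul_eq_mul, smul_eq_mul]
  ring

/-- The derivation of an algebraic curvature tensor by a skew-symmetric matrix is controlled by the
norm of the pseudo-projective part of the tensor. -/
lemma sum4_act_sq_le [DecidableEq ι] (hcard : 3 ≤ Fintype.card ι) {ψ : Matrix ι ι ℝ}
    (hψ : ψ.transpose = -ψ) {t : ι → ι → ι → ι → ℝ} (ht : IsPairSkew t)
    (hE : (ric t).transpose = ric t) :
    sum4 (fun a b c d => act ψ t a b c d ^ 2) ≤ 4 * frobSq ψ *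
      (sum4 (fun a b c d => t a b c d ^ 2) -
        2 / ((Fintype.card ι : ℝ) - 1) * frobSq (ric t)) := by
  set m : ℝ := (Fintype.card ι : ℝ) with hm
  have hm3 : 3 ≤ m := by
    rw [hm]
    exact_mod_cast hcard
  have hm2 : m - 2 ≠ 0 := by linarith
  have hm1 : m - 1 ≠ 0 := by linarith
  set E := ric t with hEdef
  -- The coefficients solve (m-2)S + (tr S)g = E, so that t minus the Kulkarni–Nomizu product of S
  -- is free of Ricci trace.
  set S : Matrix ι ι ℝ := (1 / (m - 2)) • E + (-(E.trace / (2 * (m - 1) * (m - 2)))) •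
    (1 : Matrix ι ι ℝ) with hS
  have hSt : S.transpose = S := by
    rw [hS, Matrix.transpose_add, Matrix.transpose_smul, Matrix.transpose_smul, hE,
      Matrix.transpose_one]
  have htr : S.trace = E.trace / (2 * (m - 1)) := by
    rw [hS, Matrix.trace_add, Matrix.trace_smul, Matrix.trace_smul, Matrix.trace_one, ← hm,
      smul_eq_mul, smul_eq_mul]
    field_simp
    ring
  have hES : E = (m - 2) • S + S.trace • (1 : Matrix ι ι ℝ) := by
    rw [htr, hS, smul_add, smul_smul, smul_smul, add_assoc, ← add_smul]
    rw [show (m - 2) * (1 / (m - 2)) = 1 by field_simp,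
      show (m - 2) * -(E.trace / (2 * (m - 1) * (m - 2))) + E.trace / (2 * (m - 1)) = 0 by
        field_simp; ring]
    simp
  set X := S * ψ - ψ * S with hX
  have hXtr : X.trace = 0 := by
    rw [hX, Matrix.trace_sub, Matrix.trace_mul_comm, sub_self]
  have hEX : ric (act ψ t) = (m - 2) • X := by
    rw [ric_act hψ, ← hEdef, hES, hX]
    simp only [Matrix.add_mul, Matrix.mul_add, Matrix.smul_mul, Matrix.mul_smul, Matrix.one_mul,
      Matrix.mul_one, smul_sub]
    abel
  have h1 := sum4_sub_kn_sq ht S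
  -- As X is traceless and the Ricci contraction of the derived tensor is (m-2)X, this is
  -- Pythagoras: the part from S contributes exactly 4(m-2)|X|².
  have h2 := sum4_sub_kn_sq (isPairSkew_act ht ψ) X
  rw [hEX, frobInner_smul_left, frobInner_self, hXtr] at h2
  rw [← sum4_congr (fun a b c d => congrArg (· ^ 2) (act_sub_kn hψ t S a b c d))] at h2
  have hW : IsPairSkew (fun a b c d => t a b c d - kn S a b c d) := by
    intro a b c d
    have h1 := ht a b c d
    have h2 := isPairSkew_kn S a b c d
    constructor
    · linarith [h1.1, h2.1]
    · linarith [h1.2, h2.2]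
  have h3 := sum4_act_sq_le_of_isPairSkew hψ hW
  -- The shift tr S / m leaves the traceless part of S, the best choice of constant.
  have h4 := frobSq_commutator_symm_le hSt ψ (S.trace / m)
  have h5 : frobInner E S = (m - 2) * frobSq S + S.trace ^ 2 := by
    conv_lhs => rw [hES]
    rw [frobInner_add_smul_one, frobInner_self, sq]
  have h6 : frobSq E = (m - 2) ^ 2 * frobSq S + (3 * m - 4) * S.trace ^ 2 := by
    conv_lhs => rw [hES]
    rw [frobSq_smul_add_smul_one, ← hm]
    ring
  have h7 : frobSq (S - (S.trace / m) • (1 : Matrix ι ι ℝ)) = frobSq S - S.trace ^ 2 / m := by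
    have := frobSq_smul_add_smul_one 1 (-(S.trace / m)) S
    rw [one_smul, neg_smul, ← sub_eq_add_neg] at this
    rw [this, ← hm]
    field_simp
    ring
  have h8 := frobSq_nonneg (S - (S.trace / m) • (1 : Matrix ι ι ℝ))
  have h9 := frobSq_nonneg ψ
  rw [← hEdef, h5] at h1
  rw [h6]
  rw [h1] at h3
  rw [h7] at h4 h8
  have h10 : sum4 (fun a b c d => act ψ t a b c d ^ 2) ≤ 4 * frobSq ψ *
      (sum4 (fun a b c d => t a b c d ^ 2) - 8 * ((m - 2) * frobSq S + S.trace ^ 2) +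
        4 * ((m - 2) * frobSq S + S.trace ^ 2)) +
      4 * (m - 2) * (2 * (frobSq S - S.trace ^ 2 / m) * frobSq ψ) := by
    have := mul_le_mul_of_nonneg_left h4 (show 0 ≤ 4 * (m - 2) by linarith)
    nlinarith
  refine h10.trans ?_
  -- The claimed bound exceeds the one obtained by a nonnegative multiple of the squared traceless
  -- part of S.
  have h11 : 4 * frobSq ψ * (sum4 (fun a b c d => t a b c d ^ 2) -
      2 / (m - 1) * ((m - 2) ^ 2 * frobSq S + (3 * m - 4) * S.trace ^ 2)) -
      (4 * frobSq ψ *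
      (sum4 (fun a b c d => t a b c d ^ 2) - 8 * ((m - 2) * frobSq S + S.trace ^ 2) +
        4 * ((m - 2) * frobSq S + S.trace ^ 2)) +
      4 * (m - 2) * (2 * (frobSq S - S.trace ^ 2 / m) * frobSq ψ)) =
      frobSq ψ * (8 * (m - 2) / (m - 1) * (frobSq S - S.trace ^ 2 / m)) := by
    field_simp
    ring
  have h12 : 0 ≤ frobSq ψ * (8 * (m - 2) / (m - 1) * (frobSq S - S.trace ^ 2 / m)) :=
    mul_nonneg h9 (mul_nonneg (div_nonneg (by linarith) (by linarith)) h8)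
  linarith

lemma sum_fin_four (F : (Fin 4 → ι) → ℝ) :
    ∑ i, F i = sum4 fun a b c d => F ![a, b, c, d] := by
  let e : ι × ι × ι × ι ≃ (Fin 4 → ι) :=
    { toFun := fun x => ![x.1, x.2.1, x.2.2.1, x.2.2.2]
      invFun := fun i => (i 0, i 1, i 2, i 3)
      left_inv := fun _ => rfl
      right_inv := fun i => by
        funext l
        fin_cases l <;> rfl }
  rw [← e.sum_comp]
  simp only [Fintype.sum_prod_type, sum4]
  rfl

/-- The curvature tensor of the identity of the space of `2`-forms. -/
def unitCurvature [DecidableEq ι] (a b c d : ι) : ℝ :=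
  1 / 2 * ((if a = c then 1 else 0) * (if b = d then 1 else 0)
    - (if a = d then 1 else 0) * (if b = c then 1 else 0))

lemma sum_unitCurvature_mul [DecidableEq ι] (x y : ι) (G : ι → ι → ℝ) :
    ∑ a, ∑ b, unitCurvature x a y b * G a b =
      1 / 2 * ((if x = y then ∑ a, G a a else 0) - G y x) := by
  have h (a b : ι) : unitCurvature x a y b * G a b =
      1 / 2 * ((if x = y then (if a = b then G a b else 0) else 0)
        - (if x = b then (if a = y then G a b else 0) else 0)) := by
    unfold unitCurvature
    split_ifs <;> ring
  simp only [h, ← Finset.mul_sum, Finset.sum_sub_distrib]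
  simp [Finset.sum_ite_irrel]

lemma ric_unitCurvature [DecidableEq ι] (x a : ι) :
    ∑ k, unitCurvature k x k a = if x = a then ((Fintype.card ι : ℝ) - 1) / 2 else 0 := by
  have h (k : ι) : unitCurvature k x k a =
      1 / 2 * ((if x = a then 1 else 0) - (if k = a then (if x = k then 1 else 0) else 0)) := by
    simp only [unitCurvature, if_true]
    split_ifs <;> ring
  simp only [h, ← Finset.mul_sum, Finset.sum_sub_distrib]
  simp
  split_ifs <;> ring

/-- Pointwise, Γt = 2(m-1)t - g∧E. The Ricci terms give 2(m-1)t, the traces over pairs of slots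
assemble into g∧E, and the slot transpositions cancel by the Bianchi identity. -/
lemma lichnerowiczForm_unitCurvature [DecidableEq ι] {t : ι → ι → ι → ι → ℝ} (ht : IsPairSkew t)
    (hp : ∀ a b c d, t a b c d = t c d a b)
    (hb : ∀ a b c d, t a b c d + t a c d b + t a d b c = 0) :
    lichnerowiczForm unitCurvature (fun i : Fin 4 → ι => t (i 0) (i 1) (i 2) (i 3)) =
      2 * ((Fintype.card ι : ℝ) - 1) * sum4 (fun a b c d => t a b c d ^ 2)
        - 4 * frobSq (ric t) := by
  rw [← frobInner_self, ← sum4_mul_kn ht, ← sum4_const_mul, ← sum4_sub]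
  unfold lichnerowiczForm
  rw [sum_fin_four]
  refine sum4_congr fun a b c d => ?_
  simp only [sum_unitCurvature_mul, ric_unitCurvature, ite_mul, zero_mul, Finset.sum_ite_eq,
    Finset.mem_univ, if_true, Function.update_eq_self, Fin.sum_univ_four]
  simp [Function.update, kn, ric]
  have h1 : ∑ x, t x x c d = 0 :=
    Finset.sum_eq_zero fun x _ => by linarith [(ht x x c d).1]
  have h2 : ∑ x, t a b x x = 0 :=
    Finset.sum_eq_zero fun x _ => by linarith [(ht a b x x).2]
  have h3 : ∑ x, t x b c x = -∑ x, t x b x c := by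
    rw [← Finset.sum_neg_distrib]
    exact Finset.sum_congr rfl fun x _ => (ht x b c x).2
  have h4 : ∑ x, t a x x d = -∑ x, t x a x d := by
    rw [← Finset.sum_neg_distrib]
    exact Finset.sum_congr rfl fun x _ => (ht a x x d).1
  have h5 : ∑ x, t a x c x = ∑ x, t x a x c :=
    Finset.sum_congr rfl fun x _ => by rw [(ht a x c x).1, (ht x a c x).2, neg_neg]
  have h6 : t d b c a = t a c b d := by
    rw [hp, (ht c a d b).1, (ht a c d b).2, neg_neg]
  have h7 : t a d c b = t a b c d - t a c b d := by
    linarith [hb a b c d, (ht a c d b).2, (ht a d b c).2]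
  rw [hp c b a d, h1, h2, h3, h4, h5, h6, h7, ← (neg_eq_iff_eq_neg.2 (ht a b c d).1),
    ← (neg_eq_iff_eq_neg.2 (ht a b c d).2)]
  simp only [eq_comm (a := b) (b := a), eq_comm (a := c) (b := a), eq_comm (a := d) (b := a),
    eq_comm (a := c) (b := b), eq_comm (a := d) (b := b), eq_comm (a := d) (b := c)]
  split_ifs <;> ring

end Estimates

/-! ### Spectral decomposition of the curvature operator -/

section Spectral

variable {ι : Type} [Fintype ι]

/-- The skew-symmetric matrices, as a subspace of a Euclidean space. -/
def skewSubspace (ι : Type) [Fintype ι] : Submodule ℝ (EuclideanSpace ℝ (ι × ι)) where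
  carrier := {x | ∀ a b, x (a, b) = -x (b, a)}
  add_mem' := fun hx hy a b => by simp [hx a b, hy a b, add_comm]
  zero_mem' := fun a b => by simp
  smul_mem' := fun c x hx a b => by simp [hx a b]

/-- The curvature operator on skew-symmetric matrices. -/
def skewOperator {r : ι → ι → ι → ι → ℝ} (hr : IsPairSkew r) :
    skewSubspace ι →ₗ[ℝ] skewSubspace ι where
  toFun x := ⟨WithLp.toLp 2 fun p => ∑ a, ∑ b, r a b p.1 p.2 * x.1 (a, b), fun c d => by
    simp only [← Finset.sum_neg_distrib]
    refine Finset.sum_congr rfl fun a _ => Finset.sum_congr rfl fun b _ => ?_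
    rw [(hr a b c d).2]
    ring⟩
  map_add' x y := by
    ext p
    simp [mul_add, Finset.sum_add_distrib]
  map_smul' k x := by
    ext p
    simp [Finset.mul_sum, mul_left_comm]

lemma skewOperator_apply {r : ι → ι → ι → ι → ℝ} (hr : IsPairSkew r) (x : skewSubspace ι)
    (c d : ι) : (skewOperator hr x).1 (c, d) = ∑ a, ∑ b, r a b c d * x.1 (a, b) := rfl

lemma inner_skewSubspace (x y : skewSubspace ι) :
    inner ℝ x y = ∑ a, ∑ b, x.1 (a, b) * y.1 (a, b) := by
  rw [Submodule.coe_inner, PiLp.inner_apply, Fintype.sum_prod_type]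
  exact Finset.sum_congr rfl fun a _ => Finset.sum_congr rfl fun b _ => by
    simp [mul_comm]

lemma skewOperator_isSymmetric {r : ι → ι → ι → ι → ℝ} (hr : IsPairSkew r)
    (hp : ∀ a b c d, r a b c d = r c d a b) : (skewOperator hr).IsSymmetric := by
  intro x y
  have h1 : inner ℝ (skewOperator hr x) y =
      sum4 fun c d a b => r a b c d * x.1 (a, b) * y.1 (c, d) := by
    rw [inner_skewSubspace]
    simp only [skewOperator_apply, Finset.sum_mul, sum4]
  have h2 : inner ℝ x (skewOperator hr y) =
      sum4 fun c d a b => x.1 (c, d) * (r a b c d * y.1 (a, b)) := by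
    rw [inner_skewSubspace]
    simp only [skewOperator_apply, Finset.mul_sum, sum4]
  rw [h1, h2, sum4_swap_pairs]
  refine sum4_congr fun a b c d => ?_
  rw [hp]
  ring

/-- A curvature tensor is diagonal in an orthonormal basis of skew-symmetric matrices. -/
lemma exists_spectral_decomposition [DecidableEq ι] {r : ι → ι → ι → ι → ℝ} (hr : IsPairSkew r)
    (hp : ∀ a b c d, r a b c d = r c d a b) :
    ∃ (n : ℕ) (lam : Fin n → ℝ) (ψ : Fin n → Matrix ι ι ℝ),
      (∀ α a b, ψ α a b = -ψ α b a) ∧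
      (∀ α β, frobInner (ψ α) (ψ β) = if α = β then 1 else 0) ∧
      (∀ a b c d, r a b c d = ∑ α, lam α * (ψ α a b * ψ α c d)) ∧
      ∀ a b c d, unitCurvature a b c d = ∑ α, 1 * (ψ α a b * ψ α c d) := by
  have hs := skewOperator_isSymmetric hr hp
  let b := hs.eigenvectorBasis rfl
  -- Pairing with E_ij - E_ji reads off twice the (i, j) entry of a skew matrix. Expanding it in the
  -- eigenbasis gives the completeness relation for `unitCurvature`, and applying the operator first
  -- gives the decomposition of r.
  let e (i j : ι) : skewSubspace ι :=
    ⟨WithLp.toLp 2 fun p => (if p = (i, j) then 1 else 0) - (if p = (j, i) then 1 else 0),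
      fun c d => by simp [and_comm]⟩
  have he (i j : ι) (x : skewSubspace ι) : inner ℝ x (e i j) = 2 * x.1 (i, j) := by
    have h1 : inner ℝ x (e i j) = x.1 (i, j) - x.1 (j, i) := by
      rw [Submodule.coe_inner, PiLp.inner_apply]
      simp [e, sub_mul, Finset.sum_sub_distrib]
    rw [h1, x.2 j i]
    ring
  have hexp (i j c d : ι) : (e i j).1 (c, d) = ∑ α, 2 * ((b α).1 (i, j) * (b α).1 (c, d)) := by
    conv_lhs => rw [← b.sum_repr' (e i j)]
    simp [he, mul_assoc]
  refine ⟨_, hs.eigenvalues rfl, fun α => Matrix.of fun i j => (b α).1 (i, j),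
    fun α i j => (b α).2 i j, fun α β => ?_, fun i j c d => ?_, fun i j c d => ?_⟩
  · rw [← orthonormal_iff_ite.1 b.orthonormal α β, inner_skewSubspace]
    rfl
  · have h1 : (skewOperator hr (e i j)).1 (c, d) = 2 * r i j c d := by
      rw [skewOperator_apply]
      have h2 (a b : ι) : r a b c d * (e i j).1 (a, b) =
          (if a = i then if b = j then r a b c d else 0 else 0) -
            (if a = j then if b = i then r a b c d else 0 else 0) := by
        simp only [e, Prod.mk.injEq, ite_and, mul_sub, mul_ite, mul_one, mul_zero]
      simp only [h2, Finset.sum_sub_distrib, Finset.sum_ite_irrel, Finset.sum_const_zero,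
        Finset.sum_ite_eq', Finset.mem_univ, if_true]
      rw [(hr j i c d).1]
      ring
    have h3 : skewOperator hr (e i j) =
        ∑ α, inner ℝ (b α) (e i j) • (hs.eigenvalues rfl α • b α) := by
      conv_lhs => rw [← b.sum_repr' (e i j)]
      rw [map_sum]
      refine Finset.sum_congr rfl fun α _ => ?_
      rw [map_smul, hs.apply_eigenvectorBasis]
      rfl
    have h4 : 2 * r i j c d = ∑ α, 2 * (hs.eigenvalues rfl α * ((b α).1 (i, j) * (b α).1 (c, d))) := by
      rw [← h1, h3]
      simp only [he]
      simp
      exact Finset.sum_congr rfl fun α _ => by ring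
    rw [← Finset.mul_sum] at h4
    simpa using h4
  · have h1 := hexp i j c d
    rw [← Finset.mul_sum] at h1
    simp only [e, Prod.mk.injEq] at h1
    simp only [one_mul, Matrix.of_apply]
    have h2 : unitCurvature i j c d = 1 / 2 * ((if c = i ∧ d = j then 1 else 0) -
        if c = j ∧ d = i then 1 else 0) := by
      simp only [unitCurvature, ite_and, eq_comm (a := c), eq_comm (a := d)]
      split_ifs <;> ring
    rw [h2, h1]
    ring

end Spectral

/-! ### Weighted sums with capped weights -/

/-- A weighted sum with weights at most the `k`-th part of the total is at least the total
weight times any lower bound for the averages of `k` of the values. -/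
lemma mul_sum_le_sum_mul_of_card {A : Type} [Fintype A] [DecidableEq A] {lam w : A → ℝ} {k : ℕ}
    (hk : 0 < k) {C : ℝ} (hw : ∀ α, 0 ≤ w α) (hwk : ∀ α, (k : ℝ) * w α ≤ ∑ β, w β)
    (hC : ∀ S : Finset A, S.card = k → (k : ℝ) * C ≤ ∑ α ∈ S, lam α) :
    C * ∑ α, w α ≤ ∑ α, lam α * w α := by
  have hk' : (0 : ℝ) < k := by exact_mod_cast hk
  set W := ∑ α, w α with hW
  have hW0 : 0 ≤ W := Finset.sum_nonneg fun α _ => hw α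
  by_cases hcard : k ≤ Fintype.card A
  -- S collects the k smallest values and α₀ is its largest. After subtracting the value at α₀,
  -- terms outside S are nonnegative and those inside are nonpositive, so the worst case puts the
  -- full cap W/k on each element of S.
  · obtain ⟨S, hS, hmin⟩ := Finset.exists_min_image (Finset.powersetCard k (Finset.univ : Finset A))
      (fun S => ∑ α ∈ S, lam α) (Finset.powersetCard_nonempty.2 hcard)
    have hSk : S.card = k := (Finset.mem_powersetCard.1 hS).2
    have hSne : S.Nonempty := Finset.card_pos.1 (hSk ▸ hk)
    obtain ⟨α₀, hα₀, hmax⟩ := Finset.exists_max_image S lam hSne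
    have hout : ∀ β ∉ S, lam α₀ ≤ lam β := by
      intro β hβ
      have hβ' : β ∉ S.erase α₀ := fun h => hβ (Finset.mem_of_mem_erase h)
      have h1 := hmin (insert β (S.erase α₀)) (Finset.mem_powersetCard.2
        ⟨Finset.subset_univ _, by
          rw [Finset.card_insert_of_notMem hβ', Finset.card_erase_of_mem hα₀]; omega⟩)
      rw [Finset.sum_insert hβ', ← Finset.add_sum_erase S lam hα₀] at h1
      linarith
    have h1 : ∑ α ∈ S, (lam α - lam α₀) * w α ≤ ∑ α, (lam α - lam α₀) * w α := by
      refine Finset.sum_le_sum_of_subset_of_nonneg (Finset.subset_univ S) fun β _ hβ => ?_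
      exact mul_nonneg (by linarith [hout β hβ]) (hw β)
    have h2 : ∑ α ∈ S, (lam α - lam α₀) * (W / k) ≤ ∑ α ∈ S, (lam α - lam α₀) * w α := by
      refine Finset.sum_le_sum fun α hα => ?_
      refine mul_le_mul_of_nonpos_left ?_ (by linarith [hmax α hα])
      rw [le_div_iff₀ hk']
      linarith [hwk α]
    have h3 : ∑ α ∈ S, (lam α - lam α₀) * (W / k) =
        (∑ α ∈ S, lam α) * (W / k) - lam α₀ * W := by
      rw [← Finset.sum_mul, Finset.sum_sub_distrib, Finset.sum_const, hSk, nsmul_eq_mul]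
      field_simp
    have h4 : ∑ α, (lam α - lam α₀) * w α = ∑ α, lam α * w α - lam α₀ * W := by
      simp only [sub_mul, Finset.sum_sub_distrib, ← Finset.mul_sum, hW]
    have h5 : C * W ≤ (∑ α ∈ S, lam α) * (W / k) := by
      calc C * W = (k * C) * (W / k) := by field_simp
        _ ≤ _ := mul_le_mul_of_nonneg_right (hC S hSk) (div_nonneg hW0 hk'.le)
    linarith
  -- With fewer than k indices, summing the caps gives kW ≤ |A|W, which forces all weights to
  -- vanish.
  · have h1 : (k : ℝ) * W ≤ Fintype.card A * W := by
      rw [hW, Finset.mul_sum]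
      refine (Finset.sum_le_sum fun α _ => hwk α).trans ?_
      simp [hW]
    have h2 : (Fintype.card A : ℝ) + 1 ≤ k := by
      exact_mod_cast Nat.lt_of_not_le hcard
    have h3 : W = 0 := by nlinarith
    have h4 : ∀ α, w α = 0 := fun α =>
      (Finset.sum_eq_zero_iff_of_nonneg fun α _ => hw α).1 h3 α (Finset.mem_univ α)
    simp [h3, h4]

/-! ### From tensors to components, and the bound on a Euclidean space -/

section Frame

variable {V : Type*} [NormedAddCommGroup V] [InnerProductSpace ℝ V] [FiniteDimensional ℝ V]

/-- The components of a `4`-covariant tensor in the chosen frame. -/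
def comp4 (T : (Fin 4 → V) → ℝ) (a b c d : Fin (Module.finrank ℝ V)) : ℝ :=
  T ![frame V a, frame V b, frame V c, frame V d]

lemma apply_frame_eq_comp4 (T : (Fin 4 → V) → ℝ) (i : Fin 4 → Fin (Module.finrank ℝ V)) :
    T (fun l => frame V (i l)) = comp4 T (i 0) (i 1) (i 2) (i 3) := by
  unfold comp4
  congr 1
  funext l
  fin_cases l <;> rfl

lemma tensorInner_self_eq_sum4 (T : (Fin 4 → V) → ℝ) :
    tensorInner T T = sum4 fun a b c d => comp4 T a b c d ^ 2 := by
  simp only [tensorInner, apply_frame_eq_comp4]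
  rw [sum_fin_four]
  exact sum4_congr fun a b c d => (sq _).symm

lemma tensorInner_lichnerowicz (R T : (Fin 4 → V) → ℝ) :
    tensorInner (lichnerowicz R T) T =
      lichnerowiczForm (comp4 R) (fun i : Fin 4 → _ => comp4 T (i 0) (i 1) (i 2) (i 3)) := by
  have hupd (i : Fin 4 → Fin (Module.finrank ℝ V)) (l : Fin 4) (a : Fin (Module.finrank ℝ V)) :
      Function.update (fun l => frame V (i l)) l (frame V a) =
        fun k => frame V (Function.update i l a k) :=
    (Function.comp_update (frame V) i l a).symm
  unfold tensorInner lichnerowicz lichnerowiczForm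
  simp only [hupd, apply_frame_eq_comp4 T]
  rfl

lemma ric_comp4 (T : (Fin 4 → V) → ℝ) (b d : Fin (Module.finrank ℝ V)) :
    ricciContraction T (frame V b) (frame V d) = ric (comp4 T) b d := rfl

lemma inner_frame (a b : Fin (Module.finrank ℝ V)) :
    inner ℝ (frame V a) (frame V b) = if a = b then (1 : ℝ) else 0 :=
  orthonormal_iff_ite.1 (frame V).orthonormal a b

/-- With k = 1/(m-1), the cross terms give -4k|E|² and the square of the metric part gives
2k²(m-1)|E|² = 2k|E|². -/
lemma tensorInner_pseudoProjective (hV : 1 < Module.finrank ℝ V) (T : (Fin 4 → V) → ℝ)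
    (hT : IsPairSkew (comp4 T)) :
    tensorInner (pseudoProjective T) (pseudoProjective T) =
      sum4 (fun a b c d => comp4 T a b c d ^ 2)
        - 2 / ((Module.finrank ℝ V : ℝ) - 1) * frobSq (ric (comp4 T)) := by
  have hm : (Module.finrank ℝ V : ℝ) - 1 ≠ 0 := by
    have : (1 : ℝ) < Module.finrank ℝ V := by exact_mod_cast hV
    linarith
  set k : ℝ := 1 / ((Module.finrank ℝ V : ℝ) - 1) with hk
  set E := ric (comp4 T) with hE
  set t := comp4 T with ht
  have hP (a b c d : Fin (Module.finrank ℝ V)) : comp4 (pseudoProjective T) a b c d =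
      t a b c d - k * ((if a = c then E b d else 0) - (if a = d then E b c else 0)) := by
    simp [comp4, pseudoProjective, inner_frame, ric_comp4, ht, hE, hk]
  have h1 : sum4 (fun a b c d => if a = c then t a b c d * E b d else 0) = frobSq E := by
    rw [sum4_delta13, ← frobInner_self]
    simp only [frobInner, hE, ric, Matrix.of_apply, Finset.sum_mul]
  have h2 : sum4 (fun a b c d => if a = d then t a b c d * E b c else 0) = -frobSq E := by
    rw [sum4_swap34, ← neg_eq_iff_eq_neg, ← h1, ← neg_one_mul, ← sum4_const_mul]
    refine sum4_congr fun a b c d => ?_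
    rw [(hT a b d c).2]
    split_ifs <;> ring
  have h3 : sum4 (fun a b c d => if a = c then E b d ^ 2 else 0) =
      Module.finrank ℝ V * frobSq E := by
    rw [sum4_delta13]
    simp [frobSq, Finset.mul_sum]
  have h4 : sum4 (fun a b c d => if a = d then E b c ^ 2 else 0) =
      Module.finrank ℝ V * frobSq E := by
    rw [sum4_swap34, ← h3]
  have h5 : sum4 (fun a b c d => if a = c then (if a = d then E b d * E b c else 0) else 0) =
      frobSq E := by
    rw [sum4_delta13]
    simp [frobSq, sq]
  have h6 (a b c d : Fin (Module.finrank ℝ V)) :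
      (t a b c d - k * ((if a = c then E b d else 0) - (if a = d then E b c else 0))) ^ 2 =
      t a b c d ^ 2 - 2 * k * (if a = c then t a b c d * E b d else 0)
        + 2 * k * (if a = d then t a b c d * E b c else 0)
        + k ^ 2 * (if a = c then E b d ^ 2 else 0) + k ^ 2 * (if a = d then E b c ^ 2 else 0)
        - 2 * k ^ 2 * (if a = c then (if a = d then E b d * E b c else 0) else 0) := by
    split_ifs <;> ring
  rw [tensorInner_self_eq_sum4]
  simp only [hP, h6, sum4_add, sum4_sub, sum4_const_mul, h1, h2, h3, h4, h5]
  rw [hk]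
  field_simp
  ring

/-- The `2`-form with given components in the chosen frame. -/
def twoForm (ψ : Matrix (Fin (Module.finrank ℝ V)) (Fin (Module.finrank ℝ V)) ℝ)
    (hψ : ∀ a b, ψ a b = -ψ b a) : V [⋀^Fin 2]→ₗ[ℝ] ℝ where
  toFun v := ∑ a, ∑ b, ψ a b * (inner ℝ (frame V a) (v 0) * inner ℝ (frame V b) (v 1))
  map_update_add' v i x y := by
    fin_cases i <;>
      simp [Function.update, inner_add_right, mul_add, add_mul, Finset.sum_add_distrib]
  map_update_smul' v i c x := by
    fin_cases i <;>
      simp [Function.update, inner_smul_right, Finset.mul_sum, mul_left_comm, mul_assoc]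
  map_eq_zero_of_eq' v i j hv hij := by
    have h01 : v 0 = v 1 := by
      fin_cases i <;> fin_cases j <;> simp_all
    have h1 : ∑ a, ∑ b, ψ a b * (inner ℝ (frame V a) (v 0) * inner ℝ (frame V b) (v 1)) =
        -∑ a, ∑ b, ψ a b * (inner ℝ (frame V a) (v 0) * inner ℝ (frame V b) (v 1)) := by
      conv_lhs => rw [Finset.sum_comm]
      simp only [← Finset.sum_neg_distrib]
      refine Finset.sum_congr rfl fun a _ => Finset.sum_congr rfl fun b _ => ?_
      rw [hψ b a, h01]
      ring
    linarith

lemma twoForm_frame (ψ : Matrix (Fin (Module.finrank ℝ V)) (Fin (Module.finrank ℝ V)) ℝ)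
    (hψ : ∀ a b, ψ a b = -ψ b a) (a b : Fin (Module.finrank ℝ V)) :
    twoForm ψ hψ ![frame V a, frame V b] = ψ a b := by
  simp [twoForm, inner_frame]

lemma sum_fin_two {ι : Type} [Fintype ι] (F : (Fin 2 → ι) → ℝ) :
    ∑ i, F i = ∑ a, ∑ b, F ![a, b] := by
  rw [← (finTwoArrowEquiv ι).symm.sum_comp, Fintype.sum_prod_type]
  rfl

lemma tensorInner_two (η θ : (Fin 2 → V) → ℝ) :
    tensorInner η θ =
      ∑ a, ∑ b, η ![frame V a, frame V b] * θ ![frame V a, frame V b] := by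
  have h (i : Fin 2 → Fin (Module.finrank ℝ V)) :
      (fun l => frame V (i l)) = ![frame V (i 0), frame V (i 1)] := by
    funext l
    fin_cases l <;> rfl
  unfold tensorInner
  rw [sum_fin_two]
  simp only [h]
  rfl

lemma tensorInner_curvatureOperator (R : (Fin 4 → V) → ℝ) (η : (Fin 2 → V) → ℝ) :
    tensorInner (curvatureOperator R η) η = sum4 fun c d a b => comp4 R a b c d *
      (η ![frame V a, frame V b] * η ![frame V c, frame V d]) := by
  rw [tensorInner_two]
  simp only [curvatureOperator, sum4, Finset.sum_mul, mul_assoc]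
  rfl

/-- A unit form has components of absolute value at most 1, so the quadratic form is bounded below
by minus the sum of the |R_{abcd}|. Boundedness lets the real infimum be compared with individual
competitors. -/
lemma bddBelow_partialTrace (R : (Fin 4 → V) → ℝ) (k : ℕ) :
    BddBelow (Set.range fun ψ : {ψ : Fin k → V [⋀^Fin 2]→ₗ[ℝ] ℝ //
      ∀ α β, tensorInner (ψ α) (ψ β) = if α = β then 1 else 0} =>
      (1 / (k : ℝ)) * ∑ α, tensorInner (curvatureOperator R (ψ.1 α)) (ψ.1 α)) := by
  refine ⟨(1 / (k : ℝ)) * ∑ _α : Fin k, -sum4 fun c d a b => |comp4 R a b c d|, ?_⟩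
  rintro _ ⟨ψ, rfl⟩
  refine mul_le_mul_of_nonneg_left (Finset.sum_le_sum fun α _ => ?_) (by positivity)
  have h1 (a b : Fin (Module.finrank ℝ V)) : |ψ.1 α ![frame V a, frame V b]| ≤ 1 := by
    have h := ψ.2 α α
    rw [if_pos rfl, tensorInner_two] at h
    have h2 := Finset.single_le_sum (f := fun a => ∑ b, ψ.1 α ![frame V a, frame V b] *
      ψ.1 α ![frame V a, frame V b]) (fun a _ => Finset.sum_nonneg fun b _ => mul_self_nonneg _)
      (Finset.mem_univ a)
    have h3 := Finset.single_le_sum (f := fun b => ψ.1 α ![frame V a, frame V b] *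
      ψ.1 α ![frame V a, frame V b]) (fun b _ => mul_self_nonneg _) (Finset.mem_univ b)
    rw [← sq_le_one_iff_abs_le_one]
    nlinarith
  rw [tensorInner_curvatureOperator, ← neg_one_mul, ← sum4_const_mul]
  refine sum4_le fun c d a b => ?_
  have h2 : |ψ.1 α ![frame V a, frame V b] * ψ.1 α ![frame V c, frame V d]| ≤ 1 := by
    rw [abs_mul]
    exact mul_le_one₀ (h1 a b) (abs_nonneg _) (h1 c d)
  have h3 : |comp4 R a b c d * (ψ.1 α ![frame V a, frame V b] * ψ.1 α ![frame V c, frame V d])| ≤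
      |comp4 R a b c d| := by
    rw [abs_mul]
    exact mul_le_of_le_one_right (abs_nonneg _) h2
  linarith [neg_abs_le (comp4 R a b c d *
    (ψ.1 α ![frame V a, frame V b] * ψ.1 α ![frame V c, frame V d]))]

lemma isPairSkew_comp4 {R : (Fin 4 → V) → ℝ}
    (h12 : ∀ x y z w, R ![x, y, z, w] = -R ![y, x, z, w])
    (hp : ∀ x y z w, R ![x, y, z, w] = R ![z, w, x, y]) : IsPairSkew (comp4 R) :=
  fun _ _ _ _ => ⟨h12 _ _ _ _, by unfold comp4; rw [hp, h12, hp]⟩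

/-- The Lichnerowicz bound for an algebraic curvature tensor on a Euclidean vector space. -/
theorem lichnerowicz_bound (hV : 3 ≤ Module.finrank ℝ V) {R : (Fin 4 → V) → ℝ}
    (hR12 : ∀ x y z w, R ![x, y, z, w] = -R ![y, x, z, w])
    (hRp : ∀ x y z w, R ![x, y, z, w] = R ![z, w, x, y]) {C : ℝ}
    (hC : C ≤ partialTrace R ((Module.finrank ℝ V - 1) / 2))
    {T : MultilinearMap ℝ (fun _ : Fin 4 => V) ℝ} (hT : IsAlgebraicCurvatureTensor T) :
    2 * ((Module.finrank ℝ V : ℝ) - 1) * C *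
        tensorInner (pseudoProjective T) (pseudoProjective T) ≤
      tensorInner (lichnerowicz R T) T := by
  have hr := isPairSkew_comp4 hR12 hRp
  have ht := isPairSkew_comp4 hT.antisymm hT.pair_symm
  have htp (a b c d) : comp4 T a b c d = comp4 T c d a b := hT.pair_symm _ _ _ _
  have htb (a b c d) : comp4 T a b c d + comp4 T a c d b + comp4 T a d b c = 0 :=
    hT.bianchi _ _ _ _
  obtain ⟨n, lam, ψ, hsk, horth, hdec, hunit⟩ :=
    exists_spectral_decomposition hr fun a b c d => hRp _ _ _ _
  have hskT (α : Fin n) : (ψ α).transpose = -ψ α := by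
    ext a b
    exact hsk α b a
  set m : ℝ := (Module.finrank ℝ V : ℝ) with hm
  have hm3 : 3 ≤ m := by
    rw [hm]
    exact_mod_cast hV
  set t := comp4 T with htdef
  let w (α : Fin n) : ℝ := sum4 fun a b c d => act (ψ α) t a b c d ^ 2
  have hw (α : Fin n) :
      ∑ i, derivAction (ψ α) (fun i : Fin 4 → _ => t (i 0) (i 1) (i 2) (i 3)) i ^ 2 = w α := by
    rw [sum_fin_four]
    refine sum4_congr fun a b c d => ?_
    congr 1
    simp [derivAction, act, Fin.sum_univ_four, Function.update, Finset.sum_add_distrib]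
  have hP := tensorInner_pseudoProjective (by omega) (⇑T) ht
  set N := tensorInner (pseudoProjective T) (pseudoProjective T) with hN
  have hsum : ∑ α, w α = 2 * (m - 1) * N := by
    have h1 := lichnerowiczForm_eq_sum (q := 4) hsk hunit
      (fun i : Fin 4 → _ => t (i 0) (i 1) (i 2) (i 3))
    simp only [hw, one_mul] at h1
    rw [← h1, lichnerowiczForm_unitCurvature ht htp htb, hP, Fintype.card_fin, ← hm]
    have : m - 1 ≠ 0 := by linarith
    field_simp
    ring
  have hE : (ric t).transpose = ric t := by
    ext b d
    simp only [ric, Matrix.transpose_apply, Matrix.of_apply]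
    exact Finset.sum_congr rfl fun a _ => htp a d a b
  have hwle (α : Fin n) : w α ≤ 4 * N := by
    have h1 := sum4_act_sq_le (by simpa using hV) (hskT α) ht hE
    rw [← frobInner_self (ψ α), horth, if_pos rfl, mul_one, Fintype.card_fin, ← hm, ← hP] at h1
    exact h1
  have hN0 : 0 ≤ N := by
    rw [hN, tensorInner_self_eq_sum4]
    exact Finset.sum_nonneg fun _ _ => Finset.sum_nonneg fun _ _ => Finset.sum_nonneg fun _ _ =>
      Finset.sum_nonneg fun _ _ => sq_nonneg _
  set k := (Module.finrank ℝ V - 1) / 2 with hk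
  have hk0 : 0 < k := by omega
  -- This is where the index ⌊(m-1)/2⌋ is used: 2k ≤ m-1 turns w_α ≤ 4N into k w_α ≤ 2(m-1)N, the
  -- total weight.
  have hkm : 2 * (k : ℝ) ≤ m - 1 := by
    have h1 : 2 * k + 1 ≤ Module.finrank ℝ V := by omega
    have h2 : ((2 * k + 1 : ℕ) : ℝ) ≤ Module.finrank ℝ V := by exact_mod_cast h1
    push_cast at h2
    linarith
  have hlam (α : Fin n) : tensorInner (curvatureOperator R (twoForm (ψ α) (hsk α)))
      (twoForm (ψ α) (hsk α)) = lam α := by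
    rw [tensorInner_curvatureOperator]
    simp only [twoForm_frame, hdec]
    have h1 (β : Fin n) : (sum4 fun c d a b => (ψ β a b * ψ β c d) * (ψ α a b * ψ α c d)) =
        if β = α then 1 else 0 := by
      have h2 : (sum4 fun c d a b => (ψ β a b * ψ β c d) * (ψ α a b * ψ α c d)) =
          frobInner (ψ β) (ψ α) * frobInner (ψ β) (ψ α) := by
        simp only [sum4, frobInner, Finset.sum_mul, Finset.mul_sum]
        refine Finset.sum_congr rfl fun c _ => Finset.sum_congr rfl fun d _ =>
          Finset.sum_congr rfl fun a _ => Finset.sum_congr rfl fun b _ => by ring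
      rw [h2, horth]
      split_ifs <;> simp
    have h2 : (sum4 fun c d a b => (∑ β, lam β * (ψ β a b * ψ β c d)) * (ψ α a b * ψ α c d)) =
        ∑ β, lam β * sum4 fun c d a b => (ψ β a b * ψ β c d) * (ψ α a b * ψ α c d) := by
      simp only [← sum4_const_mul]
      simp only [sum4, Finset.sum_mul, Finset.sum_comm (s := Finset.univ (α := Fin n)), mul_assoc]
    rw [h2]
    simp [h1]
  -- Any k eigenforms are an orthonormal competitor in the infimum, so their eigenvalues average at
  -- least C.
  have hS (S : Finset (Fin n)) (hSk : S.card = k) : (k : ℝ) * C ≤ ∑ α ∈ S, lam α := by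
    let e := S.orderEmbOfFin hSk
    have h1 := ciInf_le (bddBelow_partialTrace R k)
      ⟨fun j => twoForm (ψ (e j)) (hsk (e j)), fun α β => by
        rw [tensorInner_two]
        simp only [twoForm_frame]
        exact (horth (e α) (e β)).trans (by simp)⟩
    have h2 := hC.trans h1
    simp only [hlam] at h2
    have h3 : ∑ j, lam (e j) = ∑ α ∈ S, lam α := by
      rw [← Finset.sum_coe_sort S, ← (S.orderIsoOfFin hSk).toEquiv.sum_comp]
      rfl
    rw [h3, one_div_mul_eq_div, le_div_iff₀ (by exact_mod_cast hk0)] at h2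
    linarith
  have hmain := mul_sum_le_sum_mul_of_card hk0 (lam := lam) (w := w) (C := C)
    (fun α => Finset.sum_nonneg fun _ _ => Finset.sum_nonneg fun _ _ => Finset.sum_nonneg
      fun _ _ => Finset.sum_nonneg fun _ _ => sq_nonneg _)
    (fun α => by
      rw [hsum]
      have h1 := mul_le_mul_of_nonneg_left (hwle α) (Nat.cast_nonneg (α := ℝ) k)
      nlinarith) hS
  rw [tensorInner_lichnerowicz, lichnerowiczForm_eq_sum hsk hdec]
  simp only [← htdef, hw]
  rw [hsum] at hmain
  linarith

end Frame

end LichnerowiczBound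

end

theorem mainTheorem2 {m : ℕ} (hm : 3 ≤ m) {M : Type*} [TopologicalSpace M]
    [ChartedSpace (EuclideanSpace ℝ (Fin m)) M] [IsManifold (𝓡 m) ∞ M]
    [RiemannianBundle (fun x : M => TangentSpace (𝓡 m) x)]
    [IsContMDiffRiemannianBundle (𝓡 m) ∞ (EuclideanSpace ℝ (Fin m))
      (fun x : M => TangentSpace (𝓡 m) x)]
    (x : M) (C : ℝ)
    (hC : LichnerowiczBound.partialTrace (LichnerowiczBound.riemannTensor (m := m) x)
      ((m - 1) / 2) ≥ C)
    (T : MultilinearMap ℝ (fun _ : Fin 4 => TangentSpace (𝓡 m) x) ℝ)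
    (hT : LichnerowiczBound.IsAlgebraicCurvatureTensor T) :
    LichnerowiczBound.tensorInner
        (LichnerowiczBound.lichnerowicz (LichnerowiczBound.riemannTensor (m := m) x) T) T ≥
      2 * ((m : ℝ) - 1) * C *
        LichnerowiczBound.tensorInner (LichnerowiczBound.pseudoProjective T)
          (LichnerowiczBound.pseudoProjective T) := by
  have hd : Module.finrank ℝ (TangentSpace (𝓡 m) x) = m :=
    (finrank_euclideanSpace_fin : Module.finrank ℝ (EuclideanSpace ℝ (Fin m)) = m)
  have h := LichnerowiczBound.lichnerowicz_bound (V := TangentSpace (𝓡 m) x) (by rw [hd]; exact hm)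
    (LichnerowiczBound.riemannTensor_antisymm_left x)
    (LichnerowiczBound.riemannTensor_pair_symm x) (C := C) (by rw [hd]; exact hC) hT
  rw [hd] at h
  exact h
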